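/- **Definitions.** A compact quantum group $\mathbb{G}$ is described by its polynomial Hopf $*$-algebra $\mathcal{O}(\mathbb{G})$ over $\mathbb{C}$, which is linearly spanned by the coefficients of its finite-dimensional unitary corepresentations; its dual $\widehat{\mathbb{G}}$ is a discrete quantum group, and $\widehat{\mathbb{G}}_1 \cong \widehat{\mathbb{G}}_2$ means that there is a $*$-isomorphism $\mathcal{O}(\mathbb{G}_1) \cong \mathcal{O}(\mathbb{G}_2)$ that intertwines the comultiplications. For a matrix $U = (u_{st})_{s,t \in F}$ over a $*$-algebra put $U^{+1} = U$ and $U^{-1} = (u_{st}^*)_{s,t\in F}$ (its rows and columns being labelled by $s^{-1}, t^{-1}$ with $s,t \in F$). A vector $\xi$ is invariant under $U^{\varepsilon_1} \otimes \cdots \otimes U^{\varepsilon_n}$ if $\sum_{t \in F^n} \xi(t)\, (U^{\varepsilon_1})_{s_1t_1} \cdots (U^{\varepsilon_n})_{s_nt_n} = \xi(s)\, 1$ for all $s \in F^n$. *Planar quantization.* Let $\Gamma$ be a group generated by a finite subset $F$. The planar quantization of $(\Gamma,F)$ is the dual of the universal compact quantum group $\mathbb{G}_p$ for which $\mathcal{O}(\mathbb{G}_p)$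 is generated by the entries $u_{st}$ of an $F \times F$ unitary representation $U$ such that the matrix $U^{-1}$ is unitary and such that for all $n \ge 1$ and $\varepsilon \in \{\pm 1\}^n$ the vector $\xi_{n,\varepsilon} \in \ell^2(F^{\varepsilon_1} \times \cdots \times F^{\varepsilon_n})$, given by $\xi_{n,\varepsilon}(g_1,\ldots,g_n) = 1$ if $g_1 \cdots g_n = e$ in $\Gamma$ and $0$ otherwise, is invariant under $U^{\varepsilon_1} \otimes \cdots \otimes U^{\varepsilon_n}$. Here $F^{+1} = F$ and $F^{-1} = \{s^{-1} : s \in F\}$. *Triangle presentations.* Let $F$ be a finite set. A subset $T \subset F \times F \times F$ is a triangle presentation if there are a (nondegenerate) projective plane with point set $F$ and line set $L$ and a bijection $\lambda : F \to L$ such that (a) for $s,t \in F$ there is an $r \in F$ with $(s,t,r) \in T$ if and only if $t$ lies on $\lambda(s)$; (b) $(s,t,r) \in T$ implies $(t,r,s) \in T$; (c) for all $s,t \in F$ there is at most one $r \in F$ with $(s,t,r) \in T$. Let $\Gamma_T$ be the group with generating set $F$ and relations $str = e$ for all $(s,t,r) \in T$. Let $\mathbb{G}_T$ be the universal compact quantum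 group for which $\mathcal{O}(\mathbb{G}_T)$ is generated by the entries $u_{st}$ of an $F \times F$ unitary representation $U$ such that the vector $\xi_T \in \ell^2(F \times F \times F)$, the indicator function of $T$, is invariant under $U \otimes U \otimes U$. **Proposition.** Let $T \subset F \times F \times F$ be a triangle presentation. The canonical map $F \to \Gamma_T$ is injective, so that $F$ is a finite generating subset of $\Gamma_T$. For all $n \ge 1$ and $\varepsilon \in \{\pm 1\}^n$, the vector $\xi_{n,\varepsilon}$ associated with $(\Gamma_T,F)$ is $\mathbb{G}_T$-invariant, i.e. invariant under $U^{\varepsilon_1} \otimes \cdots \otimes U^{\varepsilon_n}$ for the fundamental representation $U$ of $\mathbb{G}_T$. The discrete quantum group $\widehat{\mathbb{G}_T}$ is isomorphic with the planar quantization of $(\Gamma_T,F)$, by an isomorphism $\mathcal{O}(\mathbb{G}_T) \to \mathcal{O}(\mathbb{G}_p)$ that maps $u_{st}$ to $u_{st}$ for all $s,t \in F$. -/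

import Mathlib

open scoped TensorProduct

noncomputable section

set_option linter.unusedSectionVars false

namespace PlanarQuantization

universe u

/-! ### The free unital `*`-algebra -/

/-- The free unital complex `*`-algebra on a set `X`: the free algebra on the letters
`(1, x)`, which stand for `x`, and `(-1, x)`, which stand for `x` adjoint. -/
def FreeStar (X : Type u) : Type u := FreeAlgebra ℂ (ℤˣ × X)

namespace FreeStar

variable {X : Type u}

instance : Ring (FreeStar X) := inferInstanceAs (Ring (FreeAlgebra ℂ (ℤˣ × X)))

instance : Algebra ℂ (FreeStar X) := inferInstanceAs (Algebra ℂ (FreeAlgebra ℂ (ℤˣ × X)))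

/-- The letter `(e, x)`. -/
def letter (e : ℤˣ) (x : X) : FreeStar X := FreeAlgebra.ι ℂ (e, x)

/-- The generator `x`. -/
def gen (x : X) : FreeStar X := letter 1 x

/-- Algebra homomorphisms out of the free `*`-algebra. -/
def liftLetter {B : Type*} [Semiring B] [Algebra ℂ B] (f : ℤˣ → X → B) : FreeStar X →ₐ[ℂ] B :=
  FreeAlgebra.lift ℂ (fun p : ℤˣ × X => f p.1 p.2)

@[simp] theorem liftLetter_letter {B : Type*} [Semiring B] [Algebra ℂ B] (f : ℤˣ → X → B)
    (e : ℤˣ) (x : X) : liftLetter f (letter e x) = f e x :=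
  FreeAlgebra.lift_ι_apply _ _

theorem induction {p : FreeStar X → Prop} (hs : ∀ c : ℂ, p (algebraMap ℂ _ c))
    (hg : ∀ e x, p (letter e x)) (hm : ∀ a b, p a → p b → p (a * b))
    (ha : ∀ a b, p a → p b → p (a + b)) (a : FreeStar X) : p a :=
  FreeAlgebra.induction ℂ (ℤˣ × X) hs (fun x => hg x.1 x.2) hm ha a

/-- The conjugate linear anti-multiplicative map that exchanges `x` and `x` adjoint. -/
def starHom (X : Type u) : FreeStar X →+* (FreeStar X)ᵐᵒᵖ :=
  letI alg : Algebra ℂ (FreeStar X)ᵐᵒᵖ :=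
    ((algebraMap ℂ (FreeStar X)ᵐᵒᵖ).comp (starRingEnd ℂ)).toAlgebra' fun c a =>
      Algebra.commutes (starRingEnd ℂ c) a
  (@FreeAlgebra.lift ℂ (ℤˣ × X) _ (FreeStar X)ᵐᵒᵖ _ alg
    (fun p => MulOpposite.op (letter (-p.1) p.2))).toRingHom

theorem starHom_letter (e : ℤˣ) (x : X) :
    starHom X (letter e x) = MulOpposite.op (letter (-e) x) := by
  let alg : Algebra ℂ (FreeStar X)ᵐᵒᵖ :=
    ((algebraMap ℂ (FreeStar X)ᵐᵒᵖ).comp (starRingEnd ℂ)).toAlgebra' fun c a =>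
      Algebra.commutes (starRingEnd ℂ c) a
  exact @FreeAlgebra.lift_ι_apply ℂ (ℤˣ × X) _ (FreeStar X)ᵐᵒᵖ _ alg
    (fun p => MulOpposite.op (letter (-p.1) p.2)) (e, x)

theorem starHom_algebraMap (c : ℂ) :
    starHom X (algebraMap ℂ _ c) = MulOpposite.op (algebraMap ℂ _ (starRingEnd ℂ c)) := by
  let alg : Algebra ℂ (FreeStar X)ᵐᵒᵖ :=
    ((algebraMap ℂ (FreeStar X)ᵐᵒᵖ).comp (starRingEnd ℂ)).toAlgebra' fun c a =>
      Algebra.commutes (starRingEnd ℂ c) a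
  exact (@FreeAlgebra.lift ℂ (ℤˣ × X) _ (FreeStar X)ᵐᵒᵖ _ alg
    (fun p => MulOpposite.op (letter (-p.1) p.2))).commutes c

instance : StarRing (FreeStar X) where
  star a := (starHom X a).unop
  star_involutive a := by
    induction a using induction with
    | hs c => simp [starHom_algebraMap]
    | hg e x => simp [starHom_letter]
    | hm a b ha hb => simp [ha, hb]
    | ha a b ha hb => simp [ha, hb]
  star_mul a b := by simp
  star_add a b := by simp

theorem star_def (a : FreeStar X) : star a = (starHom X a).unop := rfl

@[simp] theorem star_letter (e : ℤˣ) (x : X) : star (letter e x) = letter (-e) x := by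
  rw [star_def, starHom_letter]; rfl

theorem star_algebraMap' (c : ℂ) :
    star (algebraMap ℂ (FreeStar X) c) = algebraMap ℂ _ (star c) := by
  rw [star_def, starHom_algebraMap]; rfl

instance : StarModule ℂ (FreeStar X) where
  star_smul c a := by
    rw [Algebra.smul_def, star_mul, star_algebraMap', ← Algebra.commutes, ← Algebra.smul_def]

/-- An algebra homomorphism that respects the adjoints of the generators is a
`*`-homomorphism. -/
theorem map_star_of_letter {B : Type*} [Semiring B] [StarRing B] [Algebra ℂ B] [StarModule ℂ B]
    (f : FreeStar X →ₐ[ℂ] B) (h : ∀ e x, f (letter (-e) x) = star (f (letter e x)))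
    (a : FreeStar X) : f (star a) = star (f a) := by
  induction a using induction with
  | hs c => rw [star_algebraMap', AlgHom.commutes, AlgHom.commutes, algebraMap_star_comm]
  | hg e x => rw [star_letter, h]
  | hm a b ha hb => simp [ha, hb]
  | ha a b ha hb => simp [ha, hb]

end FreeStar

/-! ### Tensor products of representations and invariant vectors -/

section Tensor

variable {F : Type*}

/-- The entries of `U` (sign `1`) and of the conjugate matrix `V` (sign `-1`), whose entries are
the adjoints of the entries of `U`. -/
def signed {A : Type*} [Star A] (U : F → F → A) (e : ℤˣ) (s t : F) : A :=
  if e = 1 then U s t else star (U s t)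

/-- The entries `g (ε 0) (s 0) (t 0) * g (ε 1) (s 1) (t 1) * ⋯` of a tensor product of
matrices. -/
def tensorCoeff {B : Type*} [Monoid B] (g : ℤˣ → F → F → B) {n : ℕ} (ε : Fin n → ℤˣ)
    (s t : Fin n → F) : B :=
  (List.ofFn fun i => g (ε i) (s i) (t i)).prod

/-- The vector `ξ` is invariant under the tensor product of the matrices `U^{ε i}`, where `U^1`
is `U` and `U^{-1}` is the conjugate matrix of `U`. -/
def IsInvariant [Fintype F] {A : Type*} [Semiring A] [Star A] [Algebra ℂ A] (U : F → F → A)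
    {n : ℕ} (ε : Fin n → ℤˣ) (ξ : (Fin n → F) → ℂ) : Prop :=
  ∀ s : Fin n → F, ∑ t : Fin n → F, ξ t • tensorCoeff (signed U) ε s t = ξ s • (1 : A)

/-- The matrix with entries `U s t` in a `*`-algebra is unitary. -/
def IsUnitaryMatrix [Fintype F] [DecidableEq F] {A : Type*} [Semiring A] [Star A]
    (U : F → F → A) : Prop :=
  (∀ s t, ∑ k, U s k * star (U t k) = if s = t then 1 else 0) ∧
    ∀ s t, ∑ k, star (U k s) * U k t = if s = t then 1 else 0

theorem signed_one {A : Type*} [Star A] (U : F → F → A) : signed U 1 = U := by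
  funext s t; simp [signed]

theorem signed_neg_one {A : Type*} [Star A] (U : F → F → A) :
    signed U (-1) = fun s t => star (U s t) := by
  funext s t; simp [signed]

theorem signed_neg {A : Type*} [InvolutiveStar A] (U : F → F → A) (e : ℤˣ) (s t : F) :
    signed U (-e) s t = star (signed U e s t) := by
  rcases Int.units_eq_one_or e with rfl | rfl <;> simp [signed]

theorem tensorCoeff_zero {B : Type*} [Monoid B] (g : ℤˣ → F → F → B) (ε : Fin 0 → ℤˣ)
    (s t : Fin 0 → F) : tensorCoeff g ε s t = 1 := by
  simp [tensorCoeff]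

theorem tensorCoeff_succ {B : Type*} [Monoid B] (g : ℤˣ → F → F → B) {n : ℕ}
    (ε : Fin (n + 1) → ℤˣ) (s t : Fin (n + 1) → F) :
    tensorCoeff g ε s t = g (ε 0) (s 0) (t 0) *
      tensorCoeff g (fun i => ε i.succ) (fun i => s i.succ) (fun i => t i.succ) := by
  simp [tensorCoeff, List.ofFn_succ]

theorem tensorCoeff_append {B : Type*} [Monoid B] (g : ℤˣ → F → F → B) {m n : ℕ}
    (ε : Fin m → ℤˣ) (s t : Fin m → F) (ε' : Fin n → ℤˣ) (s' t' : Fin n → F) :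
    tensorCoeff g (Fin.append ε ε') (Fin.append s s') (Fin.append t t') =
      tensorCoeff g ε s t * tensorCoeff g ε' s' t' := by
  rw [tensorCoeff, tensorCoeff, tensorCoeff, ← List.prod_append, ← List.ofFn_fin_append]
  congr 2
  funext i
  refine Fin.addCases (fun i => ?_) (fun i => ?_) i <;> simp

theorem map_tensorCoeff {B C : Type*} [Monoid B] [Monoid C] (φ : B →* C)
    (g : ℤˣ → F → F → B) {n : ℕ} (ε : Fin n → ℤˣ) (s t : Fin n → F) :
    φ (tensorCoeff g ε s t) = tensorCoeff (fun e s t => φ (g e s t)) ε s t := by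
  induction n with
  | zero => simp [tensorCoeff_zero]
  | succ n ih => rw [tensorCoeff_succ, tensorCoeff_succ, map_mul, ih]

theorem sum_cons [Fintype F] {B : Type*} [AddCommMonoid B] {n : ℕ}
    (f : F → (Fin n → F) → B) :
    ∑ k : Fin (n + 1) → F, f (k 0) (fun i => k i.succ) = ∑ a : F, ∑ k : Fin n → F, f a k := by
  rw [← Fintype.sum_prod_type', ← (Fin.consEquiv (fun _ : Fin (n + 1) => F)).sum_comp]
  simp [Fin.consEquiv]

theorem ite_head_tail [DecidableEq F] {B : Type*} [Semiring B] {n : ℕ}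
    (s t : Fin (n + 1) → F) :
    (if s = t then (1 : B) else 0) =
      if s 0 = t 0 ∧ (fun i : Fin n => s i.succ) = (fun i => t i.succ) then 1 else 0 :=
  if_congr (by simp only [funext_iff, Fin.forall_fin_succ]) rfl rfl

theorem tensorCoeff_tmul [Fintype F] {A : Type*} [Ring A] [Algebra ℂ A] (g : ℤˣ → F → F → A)
    {n : ℕ} (ε : Fin n → ℤˣ) (s t : Fin n → F) :
    tensorCoeff (fun e s t => ∑ k, g e s k ⊗ₜ[ℂ] g e k t) ε s t =
      ∑ k, tensorCoeff g ε s k ⊗ₜ[ℂ] tensorCoeff g ε k t := by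
  induction n with
  | zero => simp [tensorCoeff_zero, Algebra.TensorProduct.one_def]
  | succ n ih =>
    simp only [tensorCoeff_succ]
    rw [ih, sum_cons (fun a k => (g (ε 0) (s 0) a *
      tensorCoeff g (fun i => ε i.succ) (fun i => s i.succ) k) ⊗ₜ[ℂ]
      (g (ε 0) a (t 0) * tensorCoeff g (fun i => ε i.succ) k (fun i => t i.succ))),
      Finset.sum_mul_sum]
    simp [Algebra.TensorProduct.tmul_mul_tmul]

theorem tensorCoeff_delta [DecidableEq F] {B : Type*} [Semiring B] {n : ℕ} (ε : Fin n → ℤˣ)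
    (s t : Fin n → F) :
    tensorCoeff (fun _ s t => if s = t then (1 : B) else 0) ε s t = if s = t then 1 else 0 := by
  induction n with
  | zero => simp [tensorCoeff_zero, Subsingleton.elim s t]
  | succ n ih =>
    rw [tensorCoeff_succ, ih, ite_head_tail]
    by_cases h : s 0 = t 0 <;> simp [h]

theorem tensorCoeff_unitary_right [Fintype F] [DecidableEq F] {A : Type*} [Ring A] [StarRing A]
    (g : ℤˣ → F → F → A)
    (h : ∀ e s t, ∑ k, g e s k * star (g e t k) = if s = t then 1 else 0)
    {n : ℕ} (ε : Fin n → ℤˣ) (s t : Fin n → F) :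
    ∑ k, tensorCoeff g ε s k * star (tensorCoeff g ε t k) = if s = t then 1 else 0 := by
  induction n with
  | zero => simp [tensorCoeff_zero, Subsingleton.elim s t]
  | succ n ih =>
    simp only [tensorCoeff_succ]
    rw [sum_cons (fun a k => (g (ε 0) (s 0) a *
      tensorCoeff g (fun i => ε i.succ) (fun i => s i.succ) k) *
      star (g (ε 0) (t 0) a * tensorCoeff g (fun i => ε i.succ) (fun i => t i.succ) k))]
    have : ∀ a : F, ∑ k : Fin n → F, (g (ε 0) (s 0) a *
        tensorCoeff g (fun i => ε i.succ) (fun i => s i.succ) k) *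
        star (g (ε 0) (t 0) a * tensorCoeff g (fun i => ε i.succ) (fun i => t i.succ) k) =
        g (ε 0) (s 0) a * (if (fun i : Fin n => s i.succ) = (fun i => t i.succ) then 1 else 0) *
          star (g (ε 0) (t 0) a) := by
      intro a
      rw [← ih (fun i => ε i.succ), Finset.mul_sum, Finset.sum_mul]
      exact Finset.sum_congr rfl fun k _ => by rw [star_mul]; simp only [mul_assoc]
    rw [Finset.sum_congr rfl fun a _ => this a, ite_head_tail]
    by_cases h' : (fun i : Fin n => s i.succ) = (fun i => t i.succ) <;> simp [h', h]

theorem tensorCoeff_unitary_left [Fintype F] [DecidableEq F] {A : Type*} [Ring A] [StarRing A]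
    (g : ℤˣ → F → F → A)
    (h : ∀ e s t, ∑ k, star (g e k s) * g e k t = if s = t then 1 else 0)
    {n : ℕ} (ε : Fin n → ℤˣ) (s t : Fin n → F) :
    ∑ k, star (tensorCoeff g ε k s) * tensorCoeff g ε k t = if s = t then 1 else 0 := by
  induction n with
  | zero => simp [tensorCoeff_zero, Subsingleton.elim s t]
  | succ n ih =>
    simp only [tensorCoeff_succ]
    rw [sum_cons (fun a k => star (g (ε 0) a (s 0) *
      tensorCoeff g (fun i => ε i.succ) k (fun i => s i.succ)) *
      (g (ε 0) a (t 0) * tensorCoeff g (fun i => ε i.succ) k (fun i => t i.succ))),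
      Finset.sum_comm]
    have : ∀ k : Fin n → F, ∑ a : F, star (g (ε 0) a (s 0) *
        tensorCoeff g (fun i => ε i.succ) k (fun i => s i.succ)) *
        (g (ε 0) a (t 0) * tensorCoeff g (fun i => ε i.succ) k (fun i => t i.succ)) =
        star (tensorCoeff g (fun i => ε i.succ) k (fun i => s i.succ)) *
          (if s 0 = t 0 then 1 else 0) *
          tensorCoeff g (fun i => ε i.succ) k (fun i => t i.succ) := by
      intro k
      rw [← h (ε 0), Finset.mul_sum, Finset.sum_mul]
      exact Finset.sum_congr rfl fun a _ => by rw [star_mul]; simp only [mul_assoc]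
    rw [Finset.sum_congr rfl fun k _ => this k, ite_head_tail]
    by_cases h' : s 0 = t 0 <;> simp [h', ih]

end Tensor

/-! ### Universal `*`-algebras generated by the entries of a unitary matrix -/

/-- Conditions on the entries of a unitary `F × F` matrix `U` in a `*`-algebra: whether the
conjugate matrix of `U` is required to be unitary too, and which vectors are required to be
invariant under which tensor products of `U` and its conjugate. -/
structure Conditions (F : Type u) where
  /-- The conjugate matrix is required to be unitary. -/
  conjUnitary : Prop
  /-- `ξ` is required to be invariant under the tensor product of the `U^{ε i}`. -/
  invariant : ∀ n : ℕ, (Fin n → ℤˣ) → ((Fin n → F) → ℂ) → Prop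

variable {F : Type u} [Fintype F] [DecidableEq F]

/-- The generators of the free `*`-algebra on the entries of an `F × F` matrix. -/
def freeU (s t : F) : FreeStar (F × F) := FreeStar.gen (s, t)

/-- The `*`-closed set of relations that expresses the conditions `P`. -/
inductive Rel (P : Conditions F) : FreeStar (F × F) → FreeStar (F × F) → Prop
  | unitary_right (s t : F) :
      Rel P (∑ k, freeU s k * star (freeU t k)) (if s = t then 1 else 0)
  | unitary_left (s t : F) :
      Rel P (∑ k, star (freeU k s) * freeU k t) (if s = t then 1 else 0)
  | conj_right (h : P.conjUnitary) (s t : F) :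
      Rel P (∑ k, star (freeU s k) * freeU t k) (if s = t then 1 else 0)
  | conj_left (h : P.conjUnitary) (s t : F) :
      Rel P (∑ k, freeU k s * star (freeU k t)) (if s = t then 1 else 0)
  | invariant {n : ℕ} {ε : Fin n → ℤˣ} {ξ : (Fin n → F) → ℂ} (h : P.invariant n ε ξ)
      (s : Fin n → F) :
      Rel P (∑ t : Fin n → F, ξ t • tensorCoeff (signed freeU) ε s t) (ξ s • 1)
  | star {a b : FreeStar (F × F)} (h : Rel P a b) : Rel P (star a) (star b)

/-- The universal unital `*`-algebra generated by the entries of a unitary `F × F` matrix that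
satisfies the conditions `P`. -/
def UnivAlg (P : Conditions F) : Type u := RingQuot (Rel P)

namespace UnivAlg

variable (P : Conditions F)

instance : Ring (UnivAlg P) := inferInstanceAs (Ring (RingQuot (Rel P)))

instance : Algebra ℂ (UnivAlg P) := inferInstanceAs (Algebra ℂ (RingQuot (Rel P)))

/-- The quotient homomorphism. -/
def mk : FreeStar (F × F) →ₐ[ℂ] UnivAlg P := RingQuot.mkAlgHom ℂ (Rel P)

variable {P}

theorem mk_rel {a b : FreeStar (F × F)} (h : Rel P a b) : mk P a = mk P b :=
  RingQuot.mkAlgHom_rel ℂ h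

theorem mk_surjective : Function.Surjective (mk P) := RingQuot.mkAlgHom_surjective ℂ (Rel P)

/-- Algebra homomorphisms out of the universal algebra. -/
def lift {B : Type*} [Semiring B] [Algebra ℂ B] (f : FreeStar (F × F) →ₐ[ℂ] B)
    (hf : ∀ ⦃a b⦄, Rel P a b → f a = f b) : UnivAlg P →ₐ[ℂ] B :=
  RingQuot.liftAlgHom ℂ ⟨f, hf⟩

@[simp] theorem lift_mk {B : Type*} [Semiring B] [Algebra ℂ B] (f : FreeStar (F × F) →ₐ[ℂ] B)
    (hf : ∀ ⦃a b⦄, Rel P a b → f a = f b) (a : FreeStar (F × F)) : lift f hf (mk P a) = f a :=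
  RingQuot.liftAlgHom_mkAlgHom_apply ℂ f hf a

/-- The conjugate linear anti-multiplicative map that induces the adjoint. -/
def starMk (P : Conditions F) : FreeStar (F × F) →+* (UnivAlg P)ᵐᵒᵖ :=
  (RingHom.op (mk P).toRingHom).comp (FreeStar.starHom (F × F))

theorem starMk_apply (a : FreeStar (F × F)) :
    starMk P a = MulOpposite.op (mk P (star a)) := rfl

/-- The conjugate linear anti-multiplicative map that exchanges the generators and their
adjoints. -/
def starHom (P : Conditions F) : UnivAlg P →+* (UnivAlg P)ᵐᵒᵖ :=
  RingQuot.lift (r := Rel P) ⟨starMk P, fun a b h => by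
    rw [starMk_apply, starMk_apply, mk_rel h.star]⟩

theorem starHom_mk (a : FreeStar (F × F)) :
    starHom P (mk P a) = MulOpposite.op (mk P (star a)) := by
  have h := RingQuot.lift_mkRingHom_apply (starMk P) (r := Rel P) (fun a b h => by
    rw [starMk_apply, starMk_apply, mk_rel h.star]) a
  rw [← RingQuot.mkAlgHom_coe ℂ (Rel P)] at h
  exact h

instance : StarRing (UnivAlg P) where
  star a := (starHom P a).unop
  star_involutive a := by
    obtain ⟨a, rfl⟩ := mk_surjective a
    simp [starHom_mk]
  star_mul a b := by simp
  star_add a b := by simp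

theorem mk_star (a : FreeStar (F × F)) : mk P (star a) = star (mk P a) :=
  (congrArg MulOpposite.unop (starHom_mk (P := P) a)).symm

instance : StarModule ℂ (UnivAlg P) where
  star_smul c a := by
    obtain ⟨a, rfl⟩ := mk_surjective a
    rw [← map_smul, ← mk_star, star_smul, map_smul, mk_star]

/-- The entries of the generating unitary matrix. -/
def u (P : Conditions F) (s t : F) : UnivAlg P := mk P (freeU s t)

theorem mk_signed (e : ℤˣ) (s t : F) : mk P (signed freeU e s t) = signed (u P) e s t := by
  rcases Int.units_eq_one_or e with rfl | rfl <;> simp [signed, u, mk_star]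

theorem mk_tensorCoeff {n : ℕ} (ε : Fin n → ℤˣ) (s t : Fin n → F) :
    mk P (tensorCoeff (signed freeU) ε s t) = tensorCoeff (signed (u P)) ε s t := by
  rw [← AlgHom.coe_toMonoidHom, map_tensorCoeff]
  simp [mk_signed]

theorem mk_ite (s t : F) :
    mk P (if s = t then 1 else 0) = if s = t then 1 else 0 := by
  split_ifs <;> simp

theorem u_unitary : IsUnitaryMatrix (u P) := by
  refine ⟨fun s t => ?_, fun s t => ?_⟩
  · have h := mk_rel (Rel.unitary_right (P := P) s t)
    simpa [mk_star, u, mk_ite] using h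
  · have h := mk_rel (Rel.unitary_left (P := P) s t)
    simpa [mk_star, u, mk_ite] using h

theorem u_conj_unitary (hP : P.conjUnitary) : IsUnitaryMatrix (fun s t => star (u P s t)) := by
  refine ⟨fun s t => ?_, fun s t => ?_⟩
  · have h := mk_rel (Rel.conj_right hP s t)
    simpa [mk_star, u, mk_ite] using h
  · have h := mk_rel (Rel.conj_left hP s t)
    simpa [mk_star, u, mk_ite] using h

theorem u_invariant {n : ℕ} {ε : Fin n → ℤˣ} {ξ : (Fin n → F) → ℂ} (hP : P.invariant n ε ξ) :
    IsInvariant (u P) ε ξ := by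
  intro s
  have h := mk_rel (Rel.invariant hP s)
  simpa [mk_tensorCoeff] using h

/-- The relations hold for every unitary matrix in a `*`-algebra that satisfies the conditions
`P`. -/
theorem lift_rel {B : Type*} [Ring B] [StarRing B] [Algebra ℂ B] [StarModule ℂ B]
    (U : F → F → B) (hU : IsUnitaryMatrix U)
    (hV : P.conjUnitary → IsUnitaryMatrix (fun s t => star (U s t)))
    (hI : ∀ n ε ξ, P.invariant n ε ξ → IsInvariant U ε ξ) ⦃a b : FreeStar (F × F)⦄
    (h : Rel P a b) :
    FreeStar.liftLetter (fun e (p : F × F) => signed U e p.1 p.2) a =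
      FreeStar.liftLetter (fun e (p : F × F) => signed U e p.1 p.2) b := by
  have hstar := FreeStar.map_star_of_letter
    (FreeStar.liftLetter (fun e (p : F × F) => signed U e p.1 p.2))
    (fun e x => by simp [signed_neg])
  have hu : ∀ s t, FreeStar.liftLetter (fun e (p : F × F) => signed U e p.1 p.2) (freeU s t) =
      U s t := fun s t => by simp [freeU, FreeStar.gen, signed_one]
  have hite : ∀ s t : F, FreeStar.liftLetter (fun e (p : F × F) => signed U e p.1 p.2)
      (if s = t then 1 else 0) = if s = t then 1 else 0 := fun s t => by split_ifs <;> simp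
  induction h with
  | unitary_right s t => simpa [hstar, hu, hite] using hU.1 s t
  | unitary_left s t => simpa [hstar, hu, hite] using hU.2 s t
  | conj_right h s t => simpa [hstar, hu, hite] using (hV h).1 s t
  | conj_left h s t => simpa [hstar, hu, hite] using (hV h).2 s t
  | @invariant n ε ξ h s =>
    have hsg : ∀ (e : ℤˣ) (s t : F), FreeStar.liftLetter
        (fun e (p : F × F) => signed U e p.1 p.2) (signed freeU e s t) = signed U e s t := by
      intro e s t
      rcases Int.units_eq_one_or e with rfl | rfl
      · rw [signed_one, signed_one, hu]
      · rw [signed_neg_one, signed_neg_one, hstar, hu]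
    have htc : ∀ s t, FreeStar.liftLetter
        (fun e (p : F × F) => signed U e p.1 p.2) (tensorCoeff (signed freeU) ε s t) =
        tensorCoeff (signed U) ε s t := fun s t => by
      rw [← AlgHom.coe_toMonoidHom, map_tensorCoeff]
      simp [hsg]
    simpa [htc] using hI n ε ξ h s
  | star h ih => rw [hstar, hstar, ih]

/-- The homomorphism given by the universal property. -/
def univLift {B : Type*} [Ring B] [StarRing B] [Algebra ℂ B] [StarModule ℂ B]
    (U : F → F → B) (hU : IsUnitaryMatrix U)
    (hV : P.conjUnitary → IsUnitaryMatrix (fun s t => star (U s t)))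
    (hI : ∀ n ε ξ, P.invariant n ε ξ → IsInvariant U ε ξ) : UnivAlg P →ₐ[ℂ] B :=
  lift _ (lift_rel U hU hV hI)

theorem univLift_u {B : Type*} [Ring B] [StarRing B] [Algebra ℂ B] [StarModule ℂ B]
    (U : F → F → B) (hU : IsUnitaryMatrix U)
    (hV : P.conjUnitary → IsUnitaryMatrix (fun s t => star (U s t)))
    (hI : ∀ n ε ξ, P.invariant n ε ξ → IsInvariant U ε ξ) (s t : F) :
    univLift U hU hV hI (u P s t) = U s t := by
  simp [univLift, u, freeU, FreeStar.gen, signed_one]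

theorem univLift_star {B : Type*} [Ring B] [StarRing B] [Algebra ℂ B] [StarModule ℂ B]
    (U : F → F → B) (hU : IsUnitaryMatrix U)
    (hV : P.conjUnitary → IsUnitaryMatrix (fun s t => star (U s t)))
    (hI : ∀ n ε ξ, P.invariant n ε ξ → IsInvariant U ε ξ) (a : UnivAlg P) :
    univLift U hU hV hI (star a) = star (univLift U hU hV hI a) := by
  obtain ⟨a, rfl⟩ := mk_surjective a
  rw [← mk_star, univLift, lift_mk, lift_mk]
  exact FreeStar.map_star_of_letter _ (fun e x => by simp [signed_neg]) a

/-- The entries of all tensor products of `U` and its conjugate span the universal algebra. -/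
theorem span_tensorCoeff (a : UnivAlg P) :
    a ∈ Submodule.span ℂ {b | ∃ (n : ℕ) (ε : Fin n → ℤˣ) (s t : Fin n → F),
      b = tensorCoeff (signed (u P)) ε s t} := by
  obtain ⟨a, rfl⟩ := mk_surjective a
  induction a using FreeStar.induction with
  | hs c =>
    rw [Algebra.algebraMap_eq_smul_one, map_smul, map_one]
    exact Submodule.smul_mem _ _ (Submodule.subset_span
      ⟨0, Fin.elim0, Fin.elim0, Fin.elim0, (tensorCoeff_zero _ _ _ _).symm⟩)
  | hg e x =>
    refine Submodule.subset_span ⟨1, fun _ => e, fun _ => x.1, fun _ => x.2, ?_⟩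
    rw [tensorCoeff_succ, tensorCoeff_zero, mul_one, ← mk_signed]
    congr 1
    rcases Int.units_eq_one_or e with rfl | rfl <;> simp [signed, freeU, FreeStar.gen]
  | ha a b ha hb => rw [map_add]; exact Submodule.add_mem _ ha hb
  | hm a b ha hb =>
    rw [map_mul]
    have h := Submodule.mul_mem_mul ha hb
    rw [Submodule.span_mul_span] at h
    refine Submodule.span_mono ?_ h
    rintro _ ⟨_, ⟨m, ε, s, t, rfl⟩, _, ⟨n, ε', s', t', rfl⟩, rfl⟩
    exact ⟨m + n, Fin.append ε ε', Fin.append s s', Fin.append t t',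
      (tensorCoeff_append _ _ _ _ _ _ _).symm⟩

theorem algHom_ext {B : Type*} [Semiring B] [Algebra ℂ B] {f g : UnivAlg P →ₐ[ℂ] B}
    (h : ∀ e s t, f (signed (u P) e s t) = g (signed (u P) e s t)) : f = g := by
  ext a
  obtain ⟨a, rfl⟩ := mk_surjective a
  induction a using FreeStar.induction with
  | hs c => simp
  | hg e x =>
    have hx : FreeStar.letter e x = signed freeU e x.1 x.2 := by
      rcases Int.units_eq_one_or e with rfl | rfl <;> simp [signed, freeU, FreeStar.gen]
    rw [hx, mk_signed, h]
  | hm a b ha hb => simp [ha, hb]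
  | ha a b ha hb => simp [ha, hb]

/-! ### The comultiplication, the counit and the antipode -/

theorem signed_comul {A : Type*} [Ring A] [StarRing A] [Algebra ℂ A] [StarModule ℂ A]
    (U : F → F → A) (e : ℤˣ) (s t : F) :
    signed (fun s t => ∑ k, U s k ⊗ₜ[ℂ] U k t) e s t =
      ∑ k, signed U e s k ⊗ₜ[ℂ] signed U e k t := by
  rcases Int.units_eq_one_or e with rfl | rfl
  · simp [signed_one]
  · simp [signed_neg_one, star_sum]

theorem isUnitaryMatrix_comul {A : Type*} [Ring A] [StarRing A] [Algebra ℂ A] [StarModule ℂ A]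
    {U : F → F → A} (hU : IsUnitaryMatrix U) :
    IsUnitaryMatrix (fun s t => ∑ k, U s k ⊗ₜ[ℂ] U k t) := by
  have hite : ∀ (p : Prop) [Decidable p] (x : A),
      x ⊗ₜ[ℂ] (if p then (1 : A) else 0) = if p then x ⊗ₜ 1 else 0 := by
    intro p _ x; split_ifs <;> simp
  have hite' : ∀ (p : Prop) [Decidable p] (x : A),
      (if p then (1 : A) else 0) ⊗ₜ[ℂ] x = if p then 1 ⊗ₜ x else 0 := by
    intro p _ x; split_ifs <;> simp
  constructor
  · intro s t
    calc ∑ k, (∑ a, U s a ⊗ₜ[ℂ] U a k) * star (∑ b, U t b ⊗ₜ[ℂ] U b k)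
        = ∑ a, ∑ b, ∑ k, (U s a * star (U t b)) ⊗ₜ[ℂ] (U a k * star (U b k)) := by
          simp only [star_sum, TensorProduct.star_tmul, Finset.sum_mul_sum,
            Algebra.TensorProduct.tmul_mul_tmul]
          rw [Finset.sum_comm]
          exact Finset.sum_congr rfl fun a _ => Finset.sum_comm
      _ = _ := by
          simp only [← TensorProduct.tmul_sum, hU.1, hite]
          simp only [Finset.sum_ite_eq, Finset.mem_univ, if_true]
          rw [← TensorProduct.sum_tmul, hU.1, hite', Algebra.TensorProduct.one_def]
  · intro s t
    calc ∑ k, star (∑ a, U k a ⊗ₜ[ℂ] U a s) * (∑ b, U k b ⊗ₜ[ℂ] U b t)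
        = ∑ a, ∑ b, ∑ k, (star (U k a) * U k b) ⊗ₜ[ℂ] (star (U a s) * U b t) := by
          simp only [star_sum, TensorProduct.star_tmul, Finset.sum_mul_sum,
            Algebra.TensorProduct.tmul_mul_tmul]
          rw [Finset.sum_comm]
          exact Finset.sum_congr rfl fun a _ => Finset.sum_comm
      _ = _ := by
          simp only [← TensorProduct.sum_tmul, hU.2, hite']
          simp only [Finset.sum_ite_eq, Finset.mem_univ, if_true]
          rw [← TensorProduct.tmul_sum, hU.2, hite, Algebra.TensorProduct.one_def]

theorem isInvariant_comul {n : ℕ} {ε : Fin n → ℤˣ} {ξ : (Fin n → F) → ℂ}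
    (h : P.invariant n ε ξ) :
    IsInvariant (fun s t => ∑ k, u P s k ⊗ₜ[ℂ] u P k t) ε ξ := by
  intro s
  have hs : signed (fun s t => ∑ k, u P s k ⊗ₜ[ℂ] u P k t) =
      fun e s t => ∑ k, signed (u P) e s k ⊗ₜ[ℂ] signed (u P) e k t := by
    funext e s t; exact signed_comul _ _ _ _
  simp only [hs, tensorCoeff_tmul, Finset.smul_sum, ← TensorProduct.tmul_smul]
  rw [Finset.sum_comm]
  simp only [← TensorProduct.tmul_sum, u_invariant h _]
  simp only [TensorProduct.tmul_smul, TensorProduct.smul_tmul', ← TensorProduct.sum_tmul,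
    u_invariant h s, Algebra.TensorProduct.one_def]

variable (P) in
/-- The comultiplication: `u s t` is mapped to `∑ k, u s k ⊗ u k t`. -/
def comulHom : UnivAlg P →ₐ[ℂ] UnivAlg P ⊗[ℂ] UnivAlg P :=
  univLift (fun s t => ∑ k, u P s k ⊗ₜ[ℂ] u P k t) (isUnitaryMatrix_comul u_unitary)
    (fun h => by
      simpa only [star_sum, TensorProduct.star_tmul] using
        isUnitaryMatrix_comul (u_conj_unitary h))
    (fun _ _ _ h => isInvariant_comul h)

theorem comulHom_star (a : UnivAlg P) : comulHom P (star a) = star (comulHom P a) :=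
  univLift_star _ _ _ _ a

theorem comulHom_signed (e : ℤˣ) (s t : F) :
    comulHom P (signed (u P) e s t) = ∑ k, signed (u P) e s k ⊗ₜ[ℂ] signed (u P) e k t := by
  have h : ∀ s t, comulHom P (u P s t) = ∑ k, u P s k ⊗ₜ[ℂ] u P k t :=
    fun s t => univLift_u _ _ _ _ s t
  rw [← signed_comul]
  rcases Int.units_eq_one_or e with rfl | rfl
  · rw [signed_one, signed_one, h]
  · rw [signed_neg_one, signed_neg_one, comulHom_star, h]

theorem isUnitaryMatrix_delta :
    IsUnitaryMatrix (fun s t : F => if s = t then (1 : ℂ) else 0) := by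
  constructor <;> intro s t <;> simp [eq_comm]

theorem signed_delta : signed (fun s t : F => if s = t then (1 : ℂ) else 0) =
    fun _ s t => if s = t then 1 else 0 := by
  funext e s t
  rcases Int.units_eq_one_or e with rfl | rfl <;> simp [signed]

theorem isInvariant_delta {n : ℕ} (ε : Fin n → ℤˣ) (ξ : (Fin n → F) → ℂ) :
    IsInvariant (fun s t : F => if s = t then (1 : ℂ) else 0) ε ξ := by
  intro s
  simp [signed_delta, tensorCoeff_delta]

variable (P) in
/-- The counit: `u s t` is mapped to `1` if `s = t` and to `0` otherwise. -/
def counitHom : UnivAlg P →ₐ[ℂ] ℂ :=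
  univLift (fun s t => if s = t then 1 else 0) isUnitaryMatrix_delta
    (fun _ => by simpa [apply_ite] using isUnitaryMatrix_delta)
    (fun _ ε ξ _ => isInvariant_delta ε ξ)

theorem counitHom_star (a : UnivAlg P) : counitHom P (star a) = star (counitHom P a) :=
  univLift_star _ _ _ _ a

theorem counitHom_signed (e : ℤˣ) (s t : F) :
    counitHom P (signed (u P) e s t) = if s = t then 1 else 0 := by
  have h : ∀ s t, counitHom P (u P s t) = if s = t then 1 else 0 :=
    fun s t => univLift_u _ _ _ _ s t
  rcases Int.units_eq_one_or e with rfl | rfl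
  · rw [signed_one, h]
  · rw [signed_neg_one, counitHom_star, h]
    split_ifs <;> simp

instance : Bialgebra ℂ (UnivAlg P) :=
  Bialgebra.ofAlgHom (comulHom P) (counitHom P)
    (algHom_ext fun e s t => by
      simp only [AlgHom.comp_apply, comulHom_signed, map_sum,
        Algebra.TensorProduct.map_tmul, TensorProduct.sum_tmul, TensorProduct.tmul_sum,
        AlgHom.id_apply]
      exact Finset.sum_comm)
    (algHom_ext fun e s t => by
      simp [comulHom_signed, counitHom_signed, TensorProduct.ite_tmul])
    (algHom_ext fun e s t => by
      simp [comulHom_signed, counitHom_signed, TensorProduct.tmul_ite])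

theorem comul_apply (a : UnivAlg P) : Coalgebra.comul (R := ℂ) a = comulHom P a := rfl

theorem counit_apply (a : UnivAlg P) : Coalgebra.counit (R := ℂ) a = counitHom P a := rfl

theorem comul_star (a : UnivAlg P) :
    Coalgebra.comul (R := ℂ) (star a) = star (Coalgebra.comul (R := ℂ) a) :=
  comulHom_star a

theorem comul_tensorCoeff {n : ℕ} (ε : Fin n → ℤˣ) (s t : Fin n → F) :
    Coalgebra.comul (R := ℂ) (tensorCoeff (signed (u P)) ε s t) =
      ∑ k, tensorCoeff (signed (u P)) ε s k ⊗ₜ[ℂ] tensorCoeff (signed (u P)) ε k t := by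
  rw [comul_apply, ← AlgHom.coe_toMonoidHom, map_tensorCoeff, ← tensorCoeff_tmul]
  simp [comulHom_signed]

theorem counit_tensorCoeff {n : ℕ} (ε : Fin n → ℤˣ) (s t : Fin n → F) :
    Coalgebra.counit (R := ℂ) (tensorCoeff (signed (u P)) ε s t) = if s = t then 1 else 0 := by
  rw [counit_apply, ← AlgHom.coe_toMonoidHom, map_tensorCoeff, ← tensorCoeff_delta ε s t]
  simp [counitHom_signed]

theorem tensorCoeff_right (hV : IsUnitaryMatrix (fun s t => star (u P s t))) {n : ℕ}
    (ε : Fin n → ℤˣ) (s t : Fin n → F) :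
    ∑ k, tensorCoeff (signed (u P)) ε s k * star (tensorCoeff (signed (u P)) ε t k) =
      if s = t then 1 else 0 := by
  refine tensorCoeff_unitary_right _ (fun e s t => ?_) ε s t
  rcases Int.units_eq_one_or e with rfl | rfl
  · simpa [signed_one] using u_unitary.1 s t
  · simpa [signed_neg_one] using hV.1 s t

theorem tensorCoeff_left (hV : IsUnitaryMatrix (fun s t => star (u P s t))) {n : ℕ}
    (ε : Fin n → ℤˣ) (s t : Fin n → F) :
    ∑ k, star (tensorCoeff (signed (u P)) ε k s) * tensorCoeff (signed (u P)) ε k t =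
      if s = t then 1 else 0 := by
  refine tensorCoeff_unitary_left _ (fun e s t => ?_) ε s t
  rcases Int.units_eq_one_or e with rfl | rfl
  · simpa [signed_one] using u_unitary.2 s t
  · simpa [signed_neg_one] using hV.2 s t

theorem isUnitaryMatrix_op {A : Type*} [Ring A] [StarRing A] {W : F → F → A}
    (hW : IsUnitaryMatrix W) : IsUnitaryMatrix (fun s t => MulOpposite.op (W t s)) := by
  constructor <;> intro s t
  · simpa only [← MulOpposite.op_star, ← MulOpposite.op_mul, ← Finset.op_sum, apply_ite,
      MulOpposite.op_one, MulOpposite.op_zero, eq_comm] using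
      congrArg MulOpposite.op (hW.2 t s)
  · simpa only [← MulOpposite.op_star, ← MulOpposite.op_mul, ← Finset.op_sum, apply_ite,
      MulOpposite.op_one, MulOpposite.op_zero, eq_comm] using
      congrArg MulOpposite.op (hW.1 t s)

theorem signed_op (e : ℤˣ) (s t : F) :
    signed (fun s t => MulOpposite.op (star (u P t s))) e s t =
      starRingEquiv (signed (u P) e t s) := by
  rcases Int.units_eq_one_or e with rfl | rfl
  · simp [signed_one]
  · simp [signed_neg_one, ← MulOpposite.op_star]

theorem tensorCoeff_op {n : ℕ} (ε : Fin n → ℤˣ) (s t : Fin n → F) :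
    tensorCoeff (signed fun s t => MulOpposite.op (star (u P t s))) ε s t =
      MulOpposite.op (star (tensorCoeff (signed (u P)) ε t s)) := by
  have h := map_tensorCoeff
    (starRingEquiv (R := UnivAlg P)).toMulEquiv.toMonoidHom (signed (u P)) ε t s
  have h' : MulOpposite.op (star (tensorCoeff (signed (u P)) ε t s)) =
    tensorCoeff (fun e s t => starRingEquiv (signed (u P) e s t)) ε t s := h
  rw [h']
  simp only [tensorCoeff, signed_op]

theorem isInvariant_op (hV : IsUnitaryMatrix (fun s t => star (u P s t))) {n : ℕ}
    {ε : Fin n → ℤˣ} {ξ : (Fin n → F) → ℂ} (h : P.invariant n ε ξ) :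
    IsInvariant (fun s t => MulOpposite.op (star (u P t s))) ε ξ := by
  intro s
  have key : ∑ t, ξ t • star (tensorCoeff (signed (u P)) ε t s) = ξ s • 1 := by
    calc ∑ t, ξ t • star (tensorCoeff (signed (u P)) ε t s)
        = ∑ t, star (tensorCoeff (signed (u P)) ε t s) * (ξ t • 1) := by simp
      _ = ∑ t, star (tensorCoeff (signed (u P)) ε t s) *
            ∑ r, ξ r • tensorCoeff (signed (u P)) ε t r := by
          simp only [u_invariant h _]
      _ = ∑ r, ξ r • ∑ t, star (tensorCoeff (signed (u P)) ε t s) *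
            tensorCoeff (signed (u P)) ε t r := by
          simp only [Finset.mul_sum, Finset.smul_sum, mul_smul_comm]
          exact Finset.sum_comm
      _ = ξ s • 1 := by simp [tensorCoeff_left hV]
  simp only [tensorCoeff_op, ← MulOpposite.op_smul, ← Finset.op_sum]
  rw [key]
  rfl

/-- The antipode: `u s t` is mapped to the adjoint of `u t s`. It is anti-multiplicative. -/
def antipodeHom (hV : IsUnitaryMatrix (fun s t => star (u P s t))) :
    UnivAlg P →ₐ[ℂ] (UnivAlg P)ᵐᵒᵖ :=
  univLift (fun s t => MulOpposite.op (star (u P t s))) (isUnitaryMatrix_op hV)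
    (fun _ => by
      simpa only [← MulOpposite.op_star, star_star] using isUnitaryMatrix_op u_unitary)
    (fun _ _ _ h => isInvariant_op hV h)

theorem antipodeHom_tensorCoeff (hV : IsUnitaryMatrix (fun s t => star (u P s t))) {n : ℕ}
    (ε : Fin n → ℤˣ) (s t : Fin n → F) :
    antipodeHom hV (tensorCoeff (signed (u P)) ε s t) =
      MulOpposite.op (star (tensorCoeff (signed (u P)) ε t s)) := by
  have h : ∀ s t, antipodeHom hV (u P s t) = MulOpposite.op (star (u P t s)) :=
    fun s t => univLift_u _ _ _ _ s t
  have hs : ∀ a, antipodeHom hV (star a) = star (antipodeHom hV a) :=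
    fun a => univLift_star _ _ _ _ a
  have : ∀ e s t, antipodeHom hV (signed (u P) e s t) =
      signed (fun s t => MulOpposite.op (star (u P t s))) e s t := by
    intro e s t
    rcases Int.units_eq_one_or e with rfl | rfl
    · rw [signed_one, signed_one, h]
    · rw [signed_neg_one, signed_neg_one, hs, h]
  rw [← tensorCoeff_op, ← AlgHom.coe_toMonoidHom, map_tensorCoeff]
  simp [this]

theorem linearMap_ext {B : Type*} [AddCommMonoid B] [Module ℂ B] {f g : UnivAlg P →ₗ[ℂ] B}
    (h : ∀ (n : ℕ) (ε : Fin n → ℤˣ) s t, f (tensorCoeff (signed (u P)) ε s t) =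
      g (tensorCoeff (signed (u P)) ε s t)) : f = g := by
  ext a
  refine LinearMap.eqOn_span (s := {b | ∃ (n : ℕ) (ε : Fin n → ℤˣ) (s t : Fin n → F),
      b = tensorCoeff (signed (u P)) ε s t}) ?_ (span_tensorCoeff a)
  rintro _ ⟨n, ε, s, t, rfl⟩
  exact h n ε s t

/-- The Hopf algebra structure, if the conjugate of the generating matrix is unitary. -/
abbrev hopfAlgebra (hV : IsUnitaryMatrix (fun s t => star (u P s t))) :
    HopfAlgebra ℂ (UnivAlg P) where
  antipode := (MulOpposite.opLinearEquiv ℂ).symm.toLinearMap ∘ₗ (antipodeHom hV).toLinearMap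
  mul_antipode_rTensor_comul := linearMap_ext fun n ε s t => by
    simp only [LinearMap.comp_apply, comul_tensorCoeff, map_sum, LinearMap.rTensor_tmul,
      counit_tensorCoeff, AlgHom.toLinearMap_apply, antipodeHom_tensorCoeff]
    simpa [Algebra.algebraMap_eq_smul_one] using tensorCoeff_left hV ε s t
  mul_antipode_lTensor_comul := linearMap_ext fun n ε s t => by
    simp only [LinearMap.comp_apply, comul_tensorCoeff, map_sum, LinearMap.lTensor_tmul,
      counit_tensorCoeff, AlgHom.toLinearMap_apply, antipodeHom_tensorCoeff]
    simpa [Algebra.algebraMap_eq_smul_one] using tensorCoeff_right hV ε s t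

end UnivAlg

/-! ### Compact quantum groups -/

/-- A compact quantum group `𝔾`, given by its Hopf `*`-algebra `O(𝔾)`: a complex Hopf
`*`-algebra that is linearly spanned by the coefficients of its finite dimensional unitary
corepresentations. -/
structure CompactQuantumGroup where
  /-- The polynomial `*`-algebra of the compact quantum group. -/
  O : Type u
  [ring : Ring O]
  [starRing : StarRing O]
  [hopf : HopfAlgebra ℂ O]
  [starModule : StarModule ℂ O]
  comul_star : ∀ a : O, Coalgebra.comul (R := ℂ) (star a) = star (Coalgebra.comul (R := ℂ) a)
  span_coeff : ∀ a : O, a ∈ Submodule.span ℂ {b | ∃ (d : ℕ) (w : Fin d → Fin d → O),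
    IsUnitaryMatrix w ∧ (∀ i j, Coalgebra.comul (R := ℂ) (w i j) = ∑ k, w i k ⊗ₜ[ℂ] w k j) ∧
      ∃ i j, b = w i j}

attribute [instance] CompactQuantumGroup.ring CompactQuantumGroup.starRing
  CompactQuantumGroup.hopf CompactQuantumGroup.starModule

/-- An isomorphism between compact quantum groups, or equivalently between their dual discrete
quantum groups: an isomorphism of Hopf `*`-algebras. The counit and the antipode are determined
by the comultiplication, so that they are automatically preserved. -/
structure CompactQuantumGroup.Iso (G H : CompactQuantumGroup.{u}) where
  /-- The isomorphism of `*`-algebras. -/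
  toStarAlgEquiv : G.O ≃⋆ₐ[ℂ] H.O
  comul_apply : ∀ a : G.O, Coalgebra.comul (R := ℂ) (toStarAlgEquiv a) =
    TensorProduct.map (toStarAlgEquiv : G.O →ₗ[ℂ] H.O) (toStarAlgEquiv : G.O →ₗ[ℂ] H.O)
      (Coalgebra.comul (R := ℂ) a)

/-- The universal compact quantum group generated by the entries of a unitary representation
that satisfies the conditions `P`. -/
def universalQuantumGroup (P : Conditions F)
    (hV : IsUnitaryMatrix (fun s t => star (UnivAlg.u P s t))) : CompactQuantumGroup.{u} :=
  letI := UnivAlg.hopfAlgebra hV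
  { O := UnivAlg P
    comul_star := UnivAlg.comul_star
    span_coeff := fun a => by
      refine Submodule.span_mono ?_ (UnivAlg.span_tensorCoeff a)
      rintro _ ⟨n, ε, s, t, rfl⟩
      let e := (Fintype.equivFin (Fin n → F)).symm
      have he : ∀ i j, (if e i = e j then (1 : UnivAlg P) else 0) = if i = j then 1 else 0 :=
        fun i j => if_congr e.apply_eq_iff_eq rfl rfl
      refine ⟨_, fun i j => tensorCoeff (signed (UnivAlg.u P)) ε (e i) (e j),
        ⟨fun i j => ?_, fun i j => ?_⟩, fun i j => ?_, e.symm s, e.symm t, by simp⟩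
      · rw [← he, ← UnivAlg.tensorCoeff_right hV ε]
        exact e.sum_comp fun k => tensorCoeff (signed (UnivAlg.u P)) ε (e i) k *
          star (tensorCoeff (signed (UnivAlg.u P)) ε (e j) k)
      · rw [← he, ← UnivAlg.tensorCoeff_left hV ε]
        exact e.sum_comp fun k => star (tensorCoeff (signed (UnivAlg.u P)) ε k (e i)) *
          tensorCoeff (signed (UnivAlg.u P)) ε k (e j)
      · refine (UnivAlg.comul_tensorCoeff ε (e i) (e j)).trans ?_
        exact (e.sum_comp fun k => tensorCoeff (signed (UnivAlg.u P)) ε (e i) k ⊗ₜ[ℂ]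
          tensorCoeff (signed (UnivAlg.u P)) ε k (e j)).symm }

/-! ### The planar quantization of a finitely generated group -/

section Planar

variable {Γ : Type*} [Group Γ]

open scoped Classical in
/-- The vector `ξ_{n,ε}`: its coordinate at `s` is `1` if `s₁^{ε₁} ⋯ sₙ^{εₙ} = e` in `Γ` and `0`
otherwise. Its coordinates are indexed by `s : Fin n → F`, where `s i` stands for the element
`ι (s i) ^ ε i` of the set `ι(F)^{ε i}`. -/
def xi (ι : F → Γ) {n : ℕ} (ε : Fin n → ℤˣ) (s : Fin n → F) : ℂ :=
  if (List.ofFn fun i => ι (s i) ^ (ε i : ℤ)).prod = 1 then 1 else 0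

/-- The conditions that define the planar quantization: the conjugate matrix is unitary, and all
vectors `ξ_{n,ε}` with `n ≥ 1` are invariant. -/
def planarConditions (ι : F ↪ Γ) : Conditions F where
  conjUnitary := True
  invariant n ε ξ := 1 ≤ n ∧ ξ = xi ι ε

/-- The compact quantum group whose dual is the planar quantization of `(Γ, F)`, where `F` is
viewed as a finite subset of the group `Γ` through `ι`. -/
def planarQuantumGroup (ι : F ↪ Γ) : CompactQuantumGroup.{u} :=
  universalQuantumGroup (planarConditions ι) (UnivAlg.u_conj_unitary trivial)

/-- The entries of the fundamental representation of `planarQuantumGroup ι`. -/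
def planarU (ι : F ↪ Γ) : F → F → (planarQuantumGroup ι).O := UnivAlg.u (planarConditions ι)

end Planar

/-! ### Triangle presentations -/

/-- A triangle presentation over the finite set `F`: there are a projective plane with `F` as its
set of points and a bijection `lam` from the points to the lines such that
* there is an `r` with `(s, t, r) ∈ T` if and only if the point `t` lies on the line `lam s`,
* `T` is invariant under cyclic permutations,
* for all `s` and `t`, there is at most one `r` with `(s, t, r) ∈ T`. -/
def IsTrianglePresentation {F : Type u} (T : Set (F × F × F)) : Prop :=
  ∃ (L : Type u) (_ : Membership F L) (_ : Configuration.ProjectivePlane F L) (lam : F ≃ L),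
    (∀ s t, (∃ r, (s, t, r) ∈ T) ↔ t ∈ lam s) ∧
    (∀ s t r, (s, t, r) ∈ T → (t, r, s) ∈ T) ∧
    ∀ s t r r', (s, t, r) ∈ T → (s, t, r') ∈ T → r = r'

/-- The group with generating set `F` and relations `s t r = e` for all `(s, t, r) ∈ T`. -/
abbrev TriangleGroup {F : Type u} (T : Set (F × F × F)) : Type u :=
  PresentedGroup {w : FreeGroup F | ∃ s t r, (s, t, r) ∈ T ∧
    w = FreeGroup.of s * FreeGroup.of t * FreeGroup.of r}

open scoped Classical in
/-- The vector `ξ_T`: the indicator function of `T`. -/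
def xiT (T : Set (F × F × F)) (s : Fin 3 → F) : ℂ :=
  if (s 0, s 1, s 2) ∈ T then 1 else 0

/-- The condition that defines `𝔾_T`: the vector `ξ_T` is invariant under the threefold tensor
power of `U`. -/
inductive TriangleInvariant (T : Set (F × F × F)) :
    ∀ n : ℕ, (Fin n → ℤˣ) → ((Fin n → F) → ℂ) → Prop
  | intro : TriangleInvariant T 3 (fun _ => 1) (xiT T)

/-- The conditions that define `𝔾_T`. The conjugate matrix is not required to be unitary: this
follows from the invariance of `ξ_T`, see `conj_unitary_of_triangle`. -/
def triangleConditions (T : Set (F × F × F)) : Conditions F where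
  conjUnitary := False
  invariant := TriangleInvariant T

open scoped Classical in
theorem IsTrianglePresentation.sum_eq {T : Set (F × F × F)} (hT : IsTrianglePresentation T) :
    ∃ κ : ℂ, κ ≠ 0 ∧
      (∀ p p', ∑ b, ∑ c, (if (p, b, c) ∈ T then (1 : ℂ) else 0) *
        (if (p', b, c) ∈ T then 1 else 0) = if p = p' then κ else 0) ∧
      ∀ r r', ∑ a, ∑ b, (if (a, b, r) ∈ T then (1 : ℂ) else 0) *
        (if (a, b, r') ∈ T then 1 else 0) = if r = r' then κ else 0 := by
  obtain ⟨L, _, _, lam, h1, h2, h3⟩ := hT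
  have hL : Finite L := Finite.of_equiv F lam
  have hleft : ∀ p p', ∑ b, ∑ c, (if (p, b, c) ∈ T then (1 : ℂ) else 0) *
      (if (p', b, c) ∈ T then 1 else 0) =
      if p = p' then ((Configuration.ProjectivePlane.order F L + 1 : ℕ) : ℂ) else 0 := by
    intro p p'
    by_cases hp : p = p'
    · subst hp
      rw [if_pos rfl, ← Configuration.ProjectivePlane.pointCount_eq F (lam p),
        Configuration.pointCount, Nat.card_eq_fintype_card, Fintype.card_subtype,
        Finset.card_filter, Nat.cast_sum]
      refine Finset.sum_congr rfl fun b _ => ?_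
      by_cases hb : b ∈ lam p
      · obtain ⟨r, hr⟩ := (h1 p b).2 hb
        rw [Finset.sum_eq_single r]
        · simp [hr, hb]
        · intro c _ hc
          have : (p, b, c) ∉ T := fun h => hc (h3 _ _ _ _ h hr)
          simp [this]
        · simp
      · have : ∀ c, (p, b, c) ∉ T := fun c h => hb ((h1 p b).1 ⟨c, h⟩)
        simp [hb, this]
    · rw [if_neg hp]
      refine Finset.sum_eq_zero fun b _ => Finset.sum_eq_zero fun c _ => ?_
      by_cases hb : (p, b, c) ∈ T
      · have : (p', b, c) ∉ T := fun h => hp (h3 _ _ _ _ (h2 _ _ _ hb) (h2 _ _ _ h))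
        simp [this]
      · simp [hb]
  have hcyc : ∀ a b r, (a, b, r) ∈ T ↔ (r, a, b) ∈ T := fun a b r =>
    ⟨fun h => h2 _ _ _ (h2 _ _ _ h), fun h => h2 _ _ _ h⟩
  refine ⟨_, Nat.cast_ne_zero.2 (Nat.succ_ne_zero _), hleft, fun r r' => ?_⟩
  simp only [hcyc]
  exact hleft r r'

theorem sum_rot3 {B : Type*} [AddCommMonoid B] (f : F → F → F → B) :
    ∑ a, ∑ b, ∑ c, f a b c = ∑ c, ∑ a, ∑ b, f a b c :=
  (Finset.sum_congr rfl fun _ _ => Finset.sum_comm).trans Finset.sum_comm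

theorem sum_rot4 {B : Type*} [AddCommMonoid B] (f : F → F → F → F → B) :
    ∑ a, ∑ b, ∑ c, ∑ d, f a b c d = ∑ d, ∑ a, ∑ b, ∑ c, f a b c d :=
  (Finset.sum_congr rfl fun _ _ => sum_rot3 _).trans Finset.sum_comm

theorem sum_rot5 {B : Type*} [AddCommMonoid B] (f : F → F → F → F → F → B) :
    ∑ a, ∑ b, ∑ c, ∑ d, ∑ e, f a b c d e = ∑ e, ∑ a, ∑ b, ∑ c, ∑ d, f a b c d e :=
  (Finset.sum_congr rfl fun _ _ => sum_rot4 _).trans Finset.sum_comm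

theorem sum_fin_three {B : Type*} [AddCommMonoid B] (f : F → F → F → B) :
    ∑ k : Fin 3 → F, f (k 0) (k 1) (k 2) = ∑ a, ∑ b, ∑ c, f a b c := by
  refine (sum_cons (fun a (k : Fin 2 → F) => f a (k 0) (k 1))).trans ?_
  refine Finset.sum_congr rfl fun a _ => ?_
  refine (sum_cons (fun b (k : Fin 1 → F) => f a b (k 0))).trans ?_
  refine Finset.sum_congr rfl fun b _ => ?_
  refine (sum_cons (fun c (_ : Fin 0 → F) => f a b c)).trans ?_
  simp

theorem conj_unitary_of_triangle {A : Type*} [Ring A] [StarRing A] [Algebra ℂ A]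
    [StarModule ℂ A] {T : Set (F × F × F)} (hT : IsTrianglePresentation T) {U : F → F → A}
    (hU : IsUnitaryMatrix U) (hI : IsInvariant U (fun _ => 1) (xiT T)) :
    IsUnitaryMatrix (fun s t => star (U s t)) := by
  classical
  obtain ⟨κ, hκ, hκ1, hκ2⟩ := hT.sum_eq
  obtain ⟨x, hx⟩ : ∃ x : F → F → F → ℂ,
      x = fun a b c => if (a, b, c) ∈ T then (1 : ℂ) else 0 := ⟨_, rfl⟩
  have hx1 : ∀ p p', ∑ b, ∑ c, x p b c * x p' b c = if p = p' then κ else 0 := by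
    intro p p'; rw [← hκ1, hx]
  have hx2 : ∀ r r', ∑ a, ∑ b, x a b r * x a b r' = if r = r' then κ else 0 := by
    intro p p'; rw [← hκ2, hx]
  have hxs : ∀ a b c, star (x a b c) = x a b c := by
    intro a b c; rw [hx]; dsimp only; split_ifs <;> simp
  have E0 : ∀ a b c, ∑ p, ∑ q, ∑ r, x p q r • (U a p * (U b q * U c r)) = x a b c • 1 := by
    intro a b c
    have h := hI ![a, b, c]
    rw [← sum_fin_three (fun p q r => x p q r • (U a p * (U b q * U c r))), hx]
    by_cases habc : (a, b, c) ∈ T <;>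
      simpa [tensorCoeff, List.ofFn_succ, signed_one, xiT, habc] using h
  have E1 : ∀ p b c, ∑ q, ∑ r, x p q r • (U b q * U c r) = ∑ a, x a b c • star (U a p) := by
    intro p b c
    calc ∑ q, ∑ r, x p q r • (U b q * U c r)
        = ∑ p', (∑ a, star (U a p) * U a p') * ∑ q, ∑ r, x p' q r • (U b q * U c r) := by
          simp [hU.2]
      _ = ∑ a, star (U a p) * ∑ p', ∑ q, ∑ r, x p' q r • (U a p' * (U b q * U c r)) := by
          simp only [Finset.sum_mul]
          rw [Finset.sum_comm]
          simp only [Finset.mul_sum, mul_smul_comm, mul_assoc]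
      _ = _ := by simp [E0]
  have E1' : ∀ p b c, ∑ q, ∑ r, x p q r • (star (U c r) * star (U b q)) =
      ∑ a, x a b c • U a p := by
    intro p b c
    have h := congrArg star (E1 p b c)
    simpa only [star_sum, star_smul, star_mul, star_star, hxs] using h
  have E2 : ∀ a b r, ∑ s, ∑ t, x s t r • (U s a * U t b) = ∑ c, x a b c • star (U r c) := by
    intro a b r
    calc ∑ s, ∑ t, x s t r • (U s a * U t b)
        = ∑ t, (∑ s, x s t r • U s a) * U t b := by
          simp only [Finset.sum_mul, smul_mul_assoc]
          exact Finset.sum_comm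
      _ = ∑ t, (∑ q, ∑ c, x a q c • (star (U r c) * star (U t q))) * U t b := by
          simp only [E1']
      _ = ∑ q, ∑ c, x a q c • (star (U r c) * ∑ t, star (U t q) * U t b) := by
          simp only [Finset.sum_mul, Finset.mul_sum, Finset.smul_sum, smul_mul_assoc, mul_assoc]
          rw [Finset.sum_comm]
          exact Finset.sum_congr rfl fun q _ => Finset.sum_comm
      _ = _ := by
          rw [Finset.sum_comm]
          simp [hU.2]
  have E3 : ∀ a b c, ∑ p, ∑ q, ∑ r, x p q r • (U p a * (U q b * U r c)) = x a b c • 1 := by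
    intro a b c
    calc ∑ p, ∑ q, ∑ r, x p q r • (U p a * (U q b * U r c))
        = ∑ r, (∑ p, ∑ q, x p q r • (U p a * U q b)) * U r c := by
          simp only [Finset.sum_mul, smul_mul_assoc, mul_assoc]
          exact sum_rot3 _
      _ = ∑ r, (∑ k, x a b k • star (U r k)) * U r c := by simp only [E2]
      _ = ∑ k, x a b k • ∑ r, star (U r k) * U r c := by
          simp only [Finset.sum_mul, smul_mul_assoc, Finset.smul_sum]
          exact Finset.sum_comm
      _ = _ := by simp [hU.2]
  have C1 : ∀ k t, κ • star (U k t) =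
      ∑ b, ∑ c, x k b c • ∑ q, ∑ r, x t q r • (U b q * U c r) := by
    intro k t
    calc κ • star (U k t) = ∑ a, (∑ b, ∑ c, x k b c * x a b c) • star (U a t) := by simp [hx1]
      _ = ∑ b, ∑ c, x k b c • ∑ a, x a b c • star (U a t) := by
          simp only [Finset.sum_smul, Finset.smul_sum, smul_smul]
          rw [Finset.sum_comm]
          exact Finset.sum_congr rfl fun q _ => Finset.sum_comm
      _ = _ := by simp only [E1]
  have C2 : ∀ s k, κ • star (U s k) =
      ∑ a, ∑ b, x a b k • ∑ p, ∑ q, x p q s • (U p a * U q b) := by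
    intro s k
    calc κ • star (U s k) = ∑ c, (∑ a, ∑ b, x a b k * x a b c) • star (U s c) := by simp [hx2]
      _ = ∑ a, ∑ b, x a b k • ∑ c, x a b c • star (U s c) := by
          simp only [Finset.sum_smul, Finset.smul_sum, smul_smul]
          rw [Finset.sum_comm]
          exact Finset.sum_congr rfl fun q _ => Finset.sum_comm
      _ = _ := by simp only [E2]
  have cancel : ∀ y z : A, κ • y = κ • z → y = z := fun y z h => by
    have h' := congrArg (fun w => κ⁻¹ • w) h
    simpa [smul_smul, inv_mul_cancel₀ hκ] using h'
  refine ⟨fun s t => cancel _ _ ?_, fun s t => cancel _ _ ?_⟩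
  · calc κ • ∑ k, star (U s k) * star (star (U t k))
        = ∑ k, (κ • star (U s k)) * U t k := by
          simp only [Finset.smul_sum, smul_mul_assoc, star_star]
      _ = ∑ p, ∑ q, x p q s • ∑ a, ∑ b, ∑ k, x a b k • (U p a * (U q b * U t k)) := by
          simp only [C2, Finset.sum_mul, Finset.smul_sum, smul_mul_assoc, mul_assoc]
          rw [sum_rot5, sum_rot5]
          refine Finset.sum_congr rfl fun p _ => Finset.sum_congr rfl fun q _ => ?_
          rw [sum_rot3, sum_rot3]
          exact Finset.sum_congr rfl fun a _ => Finset.sum_congr rfl fun b _ =>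
            Finset.sum_congr rfl fun k _ => smul_comm _ _ _
      _ = κ • if s = t then 1 else 0 := by
          simp only [E0, smul_smul, ← Finset.sum_smul, hx2]
          split_ifs <;> simp
  · calc κ • ∑ k, star (star (U k s)) * star (U k t)
        = ∑ k, U k s * (κ • star (U k t)) := by
          simp only [Finset.smul_sum, mul_smul_comm, star_star]
      _ = ∑ q, ∑ r, x t q r • ∑ k, ∑ b, ∑ c, x k b c • (U k s * (U b q * U c r)) := by
          simp only [C1, Finset.mul_sum, Finset.smul_sum, mul_smul_comm]
          rw [sum_rot5, sum_rot5]
          exact Finset.sum_congr rfl fun q _ => Finset.sum_congr rfl fun r _ =>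
            Finset.sum_congr rfl fun k _ => Finset.sum_congr rfl fun b _ =>
            Finset.sum_congr rfl fun c _ => smul_comm _ _ _
      _ = κ • if s = t then 1 else 0 := by
          simp only [E3, smul_smul, ← Finset.sum_smul, hx1]
          by_cases h : t = s
          · rw [if_pos h, if_pos h.symm]
          · rw [if_neg h, if_neg (Ne.symm h), zero_smul, smul_zero]

/-- The compact quantum group `𝔾_T` associated with a triangle presentation `T`: the universal
compact quantum group generated by the entries of a unitary representation `U` such that `ξ_T` is
invariant under the threefold tensor power of `U`. -/
def triangleQuantumGroup {T : Set (F × F × F)} (hT : IsTrianglePresentation T) :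
    CompactQuantumGroup.{u} :=
  universalQuantumGroup (triangleConditions T)
    (conj_unitary_of_triangle hT UnivAlg.u_unitary (UnivAlg.u_invariant .intro))

/-- The entries of the fundamental representation of `𝔾_T`. -/
def triangleU {T : Set (F × F × F)} (hT : IsTrianglePresentation T) :
    F → F → (triangleQuantumGroup hT).O :=
  UnivAlg.u (triangleConditions T)

end PlanarQuantization

/-! Everything rests on two facts about a triangle presentation: a terminating confluent rewriting
system solves the word problem in `TriangleGroup T`, and any unitary fixing the vector of `T` has
entries that are partial isometries, orthogonal along rows and columns.

Rewriting. Besides cancellation, a product of two letters of the same sign is replaced by one letter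
of the opposite sign whenever a triangle allows it, and `s t⁻¹` with `s ≠ t` becomes `u⁻¹ v` through
the point where the lines of `s` and `t` meet. Projective plane axioms resolve all overlaps
(`Rule.overlap`), so irreducible words are unique normal forms (`eq_of_irreducible`). Injectivity of
`F → Γ_T` follows, and so does the fact that `s t r = e` only for triples in `T`.

Orthogonality. Gluing two triangles along their middle letter gives the matrix `cross T`, which
intertwines `U ⊗ Ū` with `Ū ⊗ U`. For a plane of order `q`, its product with its transpose is the
sum of the identity, the rank one operator of the invariant vector `∑ e_c ⊗ e_c`, and `q - 1` times
the projection onto the span of the `e_a ⊗ e_a` (`sum_cross_mul_cross`). The first two are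
intertwiners already and `q > 1`, so the diagonal projection commutes with `U ⊗ Ū`, which is the
asserted orthogonality. Reversing all triples gives the same for products with the adjoint on the
left.

Invariance. Orthogonality makes `s ↦ ∑ U s t ⊗ t` a homomorphism from `Γ_T` to the units of `A[Γ_T]`
(`coaction`). Expanding the image of the word of `s`, the coefficient at the identity is the left
side of the invariance equation for `ξ_{n,ε}`. It equals `1` if the word is trivial. Otherwise it
depends only on the group element, so the word may be taken irreducible. The matrix coefficients
from an irreducible to a reducible word vanish (`tensorCoeff_eq_zero`), and the only irreducible
trivial word is empty, so the coefficient is `0`.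

Thus the fundamental matrix of `𝔾_T` satisfies the planar relations. Conversely `ξ_T` is
`ξ_{3,(1,1,1)}`, and the two universal properties give mutually inverse isomorphisms. -/

namespace PlanarQuantization

/-! ### Newman's lemma -/

section Newman

open Relation

/-- Newman's lemma: a terminating, locally confluent relation is confluent. -/
theorem join_of_locally_confluent {α : Type*} {r : α → α → Prop} (μ : α → ℕ)
    (hμ : ∀ a b, r a b → μ b < μ a)
    (h : ∀ a b c, r a b → r a c → Join (ReflTransGen r) b c) (a b c : α)
    (hb : ReflTransGen r a b) (hc : ReflTransGen r a c) : Join (ReflTransGen r) b c := by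
  induction hn : μ a using Nat.strong_induction_on generalizing a b c with
  | _ n ih =>
    subst hn
    rcases hb.cases_head with rfl | ⟨b', hab, hb'⟩
    · exact ⟨c, hc, .refl⟩
    rcases hc.cases_head with rfl | ⟨c', hac, hc'⟩
    · exact ⟨b, .refl, hb'.head hab⟩
    obtain ⟨d, hbd, hcd⟩ := h a b' c' hab hac
    obtain ⟨e, hbe, hde⟩ := ih _ (hμ _ _ hab) b' b d hb' hbd rfl
    obtain ⟨f, hef, hcf⟩ := ih _ (hμ _ _ hac) c' e c (hcd.trans hde) hc' rfl
    exact ⟨f, hbe.trans hef, hcf⟩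

theorem exists_irreducible {α : Type*} {r : α → α → Prop} (μ : α → ℕ)
    (hμ : ∀ a b, r a b → μ b < μ a) (a : α) :
    ∃ b, ReflTransGen r a b ∧ ∀ c, ¬ r b c := by
  induction hn : μ a using Nat.strong_induction_on generalizing a with
  | _ n ih =>
    subst hn
    by_cases h : ∃ b, r a b
    · obtain ⟨b, hb⟩ := h
      obtain ⟨c, hc, hc'⟩ := ih _ (hμ _ _ hb) b rfl
      exact ⟨c, hc.head hb, hc'⟩
    · exact ⟨a, .refl, not_exists.1 h⟩

end Newman

/-! ### The combinatorics of triangle presentations -/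

/-- The properties of a triangle presentation in terms of `T` only. They are invariant under
the reversal of all triples. -/
structure IsTriangleSystem {F : Type*} (T : Set (F × F × F)) : Prop where
  cyc : ∀ {s t r}, (s, t, r) ∈ T → (t, r, s) ∈ T
  unique : ∀ {s t r r'}, (s, t, r) ∈ T → (s, t, r') ∈ T → r = r'
  meet : ∀ {s t}, s ≠ t → ∃ w u v, (s, w, u) ∈ T ∧ (t, w, v) ∈ T
  join : ∀ {u v}, u ≠ v → ∃ w s t, (w, u, s) ∈ T ∧ (w, v, t) ∈ T
  eq_or_eq : ∀ {s t w w' a b c d}, (s, w, a) ∈ T → (t, w, b) ∈ T → (s, w', c) ∈ T →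
    (t, w', d) ∈ T → s = t ∨ w = w'

namespace IsTriangleSystem

variable {F : Type*} {T : Set (F × F × F)} (hT : IsTriangleSystem T)
include hT

theorem cyc' {s t r : F} (h : (s, t, r) ∈ T) : (r, s, t) ∈ T := hT.cyc (hT.cyc h)

theorem unique_left {s s' t r : F} (h : (s, t, r) ∈ T) (h' : (s', t, r) ∈ T) : s = s' :=
  hT.unique (hT.cyc h) (hT.cyc h')

theorem unique_mid {s t t' r : F} (h : (s, t, r) ∈ T) (h' : (s, t', r) ∈ T) : t = t' :=
  hT.unique (hT.cyc' h) (hT.cyc' h')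

/-- Projective duality: reversal exchanges `meet` and `join`, and swaps the two alternatives of
`eq_or_eq`. It halves the later work on orthogonality. -/
theorem reverse : IsTriangleSystem {p : F × F × F | (p.2.2, p.2.1, p.1) ∈ T} where
  cyc h := hT.cyc' h
  unique h h' := hT.unique_left h h'
  meet h := by
    obtain ⟨w, u, v, h, h'⟩ := hT.join h
    exact ⟨w, u, v, hT.cyc' h, hT.cyc' h'⟩
  join h := by
    obtain ⟨w, u, v, h, h'⟩ := hT.meet h
    exact ⟨w, u, v, hT.cyc' h, hT.cyc' h'⟩
  eq_or_eq h1 h2 h3 h4 :=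
    (hT.eq_or_eq (hT.cyc h1) (hT.cyc h3) (hT.cyc h2) (hT.cyc h4)).symm

end IsTriangleSystem

/-- Dictionary: `(s, w, _) ∈ T` means that the point `w` lies on the line `lam s`. So `meet` is the
intersection of two lines, `join` the line through two points, and `eq_or_eq` the uniqueness of
both. -/
theorem IsTrianglePresentation.isTriangleSystem {F : Type*} {T : Set (F × F × F)}
    (hT : IsTrianglePresentation T) : IsTriangleSystem T := by
  obtain ⟨L, _, _, lam, h1, h2, h3⟩ := hT
  refine ⟨h2 _ _ _, h3 _ _ _ _, fun {s t} h => ?_, fun {u v} h => ?_,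
    fun {s t w w' a b c d} ha hb hc hd => ?_⟩
  · have hw := Configuration.HasPoints.mkPoint_ax (P := F) (lam.injective.ne h)
    obtain ⟨u, hu⟩ := (h1 _ _).2 hw.1
    obtain ⟨v, hv⟩ := (h1 _ _).2 hw.2
    exact ⟨_, u, v, hu, hv⟩
  · have hw := Configuration.HasLines.mkLine_ax (L := L) h
    obtain ⟨w, hw'⟩ := lam.surjective (Configuration.HasLines.mkLine h)
    rw [← hw'] at hw
    obtain ⟨s, hs⟩ := (h1 _ _).2 hw.1
    obtain ⟨t, ht⟩ := (h1 _ _).2 hw.2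
    exact ⟨w, s, t, hs, ht⟩
  · rcases Configuration.Nondegenerate.eq_or_eq ((h1 _ _).1 ⟨_, ha⟩) ((h1 _ _).1 ⟨_, hc⟩)
      ((h1 _ _).1 ⟨_, hb⟩) ((h1 _ _).1 ⟨_, hd⟩) with h | h
    · exact .inr h
    · exact .inl (lam.injective h)

/-! ### A rewriting system for the triangle group -/

section Rewriting

open Relation

variable {F : Type*} {T : Set (F × F × F)}

/-- The rewriting rules: the pair of letters `a b` is replaced by a word. The letter `(true, s)`
stands for `s` and the letter `(false, s)` for `s⁻¹`. -/
inductive Rule (T : Set (F × F × F)) : Bool × F → Bool × F → List (Bool × F) → Prop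
  | cancel_right (s : F) : Rule T (true, s) (false, s) []
  | cancel_left (s : F) : Rule T (false, s) (true, s) []
  | mul {s t r : F} (h : (s, t, r) ∈ T) : Rule T (true, s) (true, t) [(false, r)]
  | mul_inv {s t r : F} (h : (s, t, r) ∈ T) : Rule T (false, t) (false, s) [(true, r)]
  -- From `s = u⁻¹ w⁻¹` and `t⁻¹ = w v`. Moving inverses to the left makes every positive letter
  -- followed by an inverse reducible, since two distinct lines always meet.
  | swap {s t w u v : F} (hst : s ≠ t) (h : (s, w, u) ∈ T) (h' : (t, w, v) ∈ T) :
      Rule T (true, s) (false, t) [(false, u), (true, v)]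

/-- A rewriting step. -/
inductive Step (T : Set (F × F × F)) : List (Bool × F) → List (Bool × F) → Prop
  | head {a b : Bool × F} {r : List (Bool × F)} (h : Rule T a b r) (l : List (Bool × F)) :
      Step T (a :: b :: l) (r ++ l)
  | cons (a : Bool × F) {l l' : List (Bool × F)} (h : Step T l l') : Step T (a :: l) (a :: l')

/-- A weight of words that decreases with each rewriting step. -/
def weight : List (Bool × F) → ℕ
  -- The word is read as a binary numeral whose head is the lowest digit, with an extra leading
  -- digit `1`. Without that digit `mul` would not decrease the weight at the end of a word; `swap`
  -- lowers it by moving a `1` to a lower place.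
  | [] => 1
  | a :: l => 2 * weight l + if a.1 then 0 else 1

theorem weight_pos : ∀ l : List (Bool × F), 0 < weight l
  | [] => Nat.one_pos
  | a :: l => by have := weight_pos l; simp only [weight]; omega

theorem Step.weight_lt {l l' : List (Bool × F)} (h : Step T l l') : weight l' < weight l := by
  induction h with
  | @head a b r h l =>
    have := weight_pos l
    cases h <;> simp [weight] <;> omega
  | cons a h ih => simp only [weight]; omega

theorem Step.append_right {l l' : List (Bool × F)} (h : Step T l l') (m : List (Bool × F)) :
    Step T (l ++ m) (l' ++ m) := by
  induction h with
  | head h l => simpa using Step.head h (l ++ m)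
  | cons a h ih => exact ih.cons a

theorem Step.append_left {l l' : List (Bool × F)} (h : Step T l l') :
    ∀ m : List (Bool × F), Step T (m ++ l) (m ++ l')
  | [] => h
  | a :: m => (h.append_left m).cons a

/-- Reduction of words in several steps. -/
abbrev Reduces (T : Set (F × F × F)) : List (Bool × F) → List (Bool × F) → Prop :=
  ReflTransGen (Step T)

theorem Reduces.append {l l' m m' : List (Bool × F)} (h : Reduces T l l') (h' : Reduces T m m') :
    Reduces T (l ++ m) (l' ++ m') :=
  (h.lift (· ++ m) fun _ _ h => h.append_right m).trans
    (h'.lift (l' ++ ·) fun _ _ h => h.append_left l')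

theorem Reduces.cons (a : Bool × F) {l l' : List (Bool × F)} (h : Reduces T l l') :
    Reduces T (a :: l) (a :: l') := h.lift (a :: ·) fun _ _ h => h.cons a

theorem Rule.reduces {a b : Bool × F} {r : List (Bool × F)} (h : Rule T a b r)
    (l : List (Bool × F)) : Reduces T (a :: b :: l) (r ++ l) := .single (.head h l)

/-- For `swap` this is the fact that two distinct lines have only one common point. -/
theorem Rule.unique (hT : IsTriangleSystem T) {a b : Bool × F} {r r' : List (Bool × F)}
    (h : Rule T a b r) (h' : Rule T a b r') : r = r' := by
  cases h with
  | cancel_right s => cases h' with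
    | cancel_right => rfl
    | swap hst => exact absurd rfl hst
  | cancel_left s => cases h'; rfl
  | mul h => cases h' with | mul h' => rw [hT.unique h h']
  | mul_inv h => cases h' with | mul_inv h' => rw [hT.unique h h']
  | swap hst h1 h2 => cases h' with
    | cancel_right => exact absurd rfl hst
    | swap _ h3 h4 =>
      obtain rfl := (hT.eq_or_eq h1 h2 h3 h4).resolve_left hst
      rw [hT.unique h1 h3, hT.unique h2 h4]

/-- The critical pairs. Typically, for `s t u` with triangles `(s, t, r)` and `(t, u, q)`, the two
results are `r⁻¹ u` and `s q⁻¹`; the triangles `(s, t, r)` and `(q, t, u)` share their middle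
letter, so `swap` takes the second to the first. If instead `r = u`, then `s = q` and both sides
cancel. The other cases without a cancellation rule are similar: a coincidence of letters gives a
collapse, and distinct letters give a `swap`. -/
theorem Rule.overlap (hT : IsTriangleSystem T) {a b c : Bool × F} {r r' : List (Bool × F)}
    (h : Rule T a b r) (h' : Rule T b c r') :
    Join (Reduces T) (r ++ [c]) (a :: r') := by
  have cr : ∀ (s : F) l, Reduces T ((true, s) :: (false, s) :: l) l :=
    fun s l => (Rule.cancel_right s).reduces l
  have cl : ∀ (s : F) l, Reduces T ((false, s) :: (true, s) :: l) l :=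
    fun s l => (Rule.cancel_left s).reduces l
  cases h with
  | cancel_right s =>
    cases h' with
    | cancel_left => exact ⟨_, .refl, .refl⟩
    | @mul_inv t _ r h =>
      exact ⟨_, .refl, (Rule.mul (hT.cyc h)).reduces []⟩
  | cancel_left s =>
    cases h' with
    | cancel_right => exact ⟨_, .refl, .refl⟩
    | mul h => exact ⟨_, .refl, (Rule.mul_inv (hT.cyc' h)).reduces []⟩
    | @swap _ t w u v hst h h' =>
      exact ⟨[(false, t)], .refl, ((Rule.mul_inv (hT.cyc' h)).reduces [(true, v)]).trans
        ((Rule.mul (hT.cyc h')).reduces [])⟩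
  | @mul s t r h =>
    cases h' with
    | cancel_right => exact ⟨[(true, s)], (Rule.mul_inv (hT.cyc h)).reduces [], .refl⟩
    | @mul _ u q h' =>
      by_cases hru : r = u
      · subst hru
        obtain rfl := hT.unique (hT.cyc h) h'
        exact ⟨[], cl r [], cr s []⟩
      · refine ⟨_, .refl, (Rule.swap ?_ h (hT.cyc' h')).reduces []⟩
        rintro rfl
        exact hru (hT.unique h (hT.cyc' h'))
    | @swap _ u w a b htu h1 h2 =>
      by_cases hsa : s = a
      · subst hsa
        obtain rfl := hT.unique_mid (hT.cyc h) h1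
        exact ⟨[(true, b)], (Rule.mul_inv h2).reduces [], cr s _⟩
      · refine ⟨_, .refl, ((Rule.swap hsa h (hT.cyc' h1)).reduces [(true, b)]).trans ?_⟩
        exact ((Rule.mul (hT.cyc h2)).reduces []).cons _
  | @mul_inv t s r h =>
    cases h' with
    | cancel_left => exact ⟨[(false, s)], (Rule.mul (hT.cyc' h)).reduces [], .refl⟩
    | @mul_inv u _ q h' =>
      by_cases hru : r = u
      · subst hru
        obtain rfl := hT.unique_mid h (hT.cyc h')
        exact ⟨[], cr r [], cl _ []⟩
      · exact ⟨_, (Rule.swap hru (hT.cyc' h) h').reduces [], .refl⟩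
  | @swap s t w a b hst h1 h2 =>
    cases h' with
    | cancel_left =>
      exact ⟨[(true, s)], (((Rule.mul (hT.cyc' h2)).reduces []).cons _).trans
        ((Rule.mul_inv (hT.cyc h1)).reduces []), .refl⟩
    | @mul_inv u _ r h =>
      by_cases hbu : b = u
      · subst hbu
        obtain rfl := hT.unique_mid h2 (hT.cyc h)
        exact ⟨[(false, a)], (cr b []).cons _, (Rule.mul h1).reduces []⟩
      · exact ⟨_, (((Rule.swap hbu (hT.cyc' h2) h).reduces []).cons _).trans
          ((Rule.mul_inv (hT.cyc h1)).reduces _), .refl⟩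

/-- Two steps act on the same pair, on overlapping pairs, or on disjoint pairs; in the last case
they commute. -/
theorem Step.locally_confluent (hT : IsTriangleSystem T) (l m m' : List (Bool × F))
    (h : Step T l m) (h' : Step T l m') : Join (Reduces T) m m' := by
  induction h generalizing m' with
  | @head a b r h l =>
    cases h' with
    | head h' => rw [h.unique hT h']; exact ⟨_, .refl, .refl⟩
    | cons _ h' =>
      cases h' with
      | @head _ c r' h' l =>
        obtain ⟨d, hd, hd'⟩ := h.overlap hT h'
        exact ⟨d ++ l, by simpa using hd.append (.refl (a := l)),
          by simpa using hd'.append (.refl (a := l))⟩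
      | cons _ h' =>
        exact ⟨_, .single (h'.append_left r), .single (.head h _)⟩
  | @cons a l l' h ih =>
    cases h' with
    | cons _ h' =>
      obtain ⟨d, hd, hd'⟩ := ih _ h'
      exact ⟨a :: d, hd.cons a, hd'.cons a⟩
    | @head _ b r h' l =>
      cases h with
      | @head _ c r' h l =>
        obtain ⟨d, hd, hd'⟩ := h'.overlap hT h
        exact ⟨d ++ l, by simpa using hd'.append (.refl (a := l)),
          by simpa using hd.append (.refl (a := l))⟩
      | cons _ h => exact ⟨_, .single (.head h' _), .single (h.append_left r)⟩

theorem Reduces.confluent (hT : IsTriangleSystem T) (l m m' : List (Bool × F))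
    (h : Reduces T l m) (h' : Reduces T l m') : Join (Reduces T) m m' :=
  join_of_locally_confluent weight (fun _ _ h => h.weight_lt) (Step.locally_confluent hT)
    l m m' h h'

/-- The congruence generated by the rewriting system. -/
def reductionCon (hT : IsTriangleSystem T) : Con (FreeMonoid (Bool × F)) where
  r l m := Join (Reduces T) l.toList m.toList
  iseqv := by
    -- Confluence is what makes joinability transitive.
    have h := equivalence_join (r := Reduces T) (Reduces.confluent hT)
    exact ⟨fun _ => h.refl _, h.symm, h.trans⟩
  mul' := by
    rintro _ _ _ _ ⟨d, h, h'⟩ ⟨e, k, k'⟩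
    exact ⟨d ++ e, h.append k, h'.append k'⟩

/-! ### The word problem in the triangle group -/

/-- The element of the triangle group that is represented by a letter. -/
def letterVal (T : Set (F × F × F)) (a : Bool × F) : TriangleGroup T :=
  if a.1 then PresentedGroup.of a.2 else (PresentedGroup.of a.2)⁻¹

@[simp] theorem letterVal_true (s : F) : letterVal T (true, s) = PresentedGroup.of s := by
  simp [letterVal]

@[simp] theorem letterVal_false (s : F) : letterVal T (false, s) = (PresentedGroup.of s)⁻¹ := by
  simp [letterVal]

theorem of_mul_of_mul_of {s t r : F} (h : (s, t, r) ∈ T) :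
    (PresentedGroup.of s : TriangleGroup T) * PresentedGroup.of t * PresentedGroup.of r = 1 :=
  PresentedGroup.one_of_mem (rels := {w : FreeGroup F | ∃ s t r, (s, t, r) ∈ T ∧
    w = FreeGroup.of s * FreeGroup.of t * FreeGroup.of r}) ⟨s, t, r, h, rfl⟩

/-- The element of the triangle group that is represented by a word. -/
def wordVal (T : Set (F × F × F)) (l : List (Bool × F)) : TriangleGroup T :=
  (l.map (letterVal T)).prod

@[simp] theorem wordVal_nil : wordVal T [] = 1 := rfl

@[simp] theorem wordVal_cons (a : Bool × F) (l : List (Bool × F)) :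
    wordVal T (a :: l) = letterVal T a * wordVal T l := by simp [wordVal]

@[simp] theorem wordVal_append (l m : List (Bool × F)) :
    wordVal T (l ++ m) = wordVal T l * wordVal T m := by simp [wordVal]

theorem Rule.wordVal_eq {a b : Bool × F} {r : List (Bool × F)} (h : Rule T a b r) :
    wordVal T r = letterVal T a * letterVal T b := by
  cases h with
  | cancel_right => simp
  | cancel_left => simp
  | mul h => simpa using (eq_inv_of_mul_eq_one_left (of_mul_of_mul_of h)).symm
  | mul_inv h => simpa using eq_inv_of_mul_eq_one_right (of_mul_of_mul_of h)
  | @swap s t w u v _ h h' =>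
    have e := eq_inv_of_mul_eq_one_left (of_mul_of_mul_of h)
    have e' := eq_inv_of_mul_eq_one_right (of_mul_of_mul_of h')
    simp [e', ← e]

theorem Step.wordVal_eq {l m : List (Bool × F)} (h : Step T l m) : wordVal T m = wordVal T l := by
  induction h with
  | head h l => simp [h.wordVal_eq, mul_assoc]
  | cons a h ih => simp [ih]

theorem Reduces.wordVal_eq {l m : List (Bool × F)} (h : Reduces T l m) :
    wordVal T m = wordVal T l := by
  induction h with
  | refl => rfl
  | tail _ h ih => rw [h.wordVal_eq, ih]

/-- A letter as an invertible element of the quotient by the rewriting system. -/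
def letterUnit (hT : IsTriangleSystem T) (s : F) : (reductionCon hT).Quotientˣ where
  val := (FreeMonoid.of (true, s) : FreeMonoid (Bool × F))
  inv := (FreeMonoid.of (false, s) : FreeMonoid (Bool × F))
  val_inv := (Con.eq _).2 ⟨[], (Rule.cancel_right s).reduces [], .refl⟩
  inv_val := (Con.eq _).2 ⟨[], (Rule.cancel_left s).reduces [], .refl⟩

/-- The homomorphism from the triangle group to the quotient by the rewriting system. -/
def toReduction (hT : IsTriangleSystem T) : TriangleGroup T →* (reductionCon hT).Quotientˣ :=
  PresentedGroup.toGroup (f := letterUnit hT) (by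
    rintro _ ⟨s, t, r, h, rfl⟩
    simp only [map_mul, FreeGroup.lift_apply_of]
    refine Units.ext ((Con.eq _).2 ⟨[], ?_, .refl⟩)
    exact ((Rule.mul h).reduces [(true, r)]).trans ((Rule.cancel_left r).reduces []))

theorem toReduction_wordVal (hT : IsTriangleSystem T) (l : List (Bool × F)) :
    ((toReduction hT (wordVal T l) : (reductionCon hT).Quotientˣ) : (reductionCon hT).Quotient) =
      (FreeMonoid.ofList l : FreeMonoid (Bool × F)) := by
  induction l with
  | nil => simp
  | cons a l ih =>
    rw [wordVal_cons, map_mul, Units.val_mul, ih, FreeMonoid.ofList_cons, Con.coe_mul]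
    congr 1
    rcases a with ⟨_ | _, s⟩
    · rw [letterVal_false, map_inv, toReduction, PresentedGroup.toGroup.of]; rfl
    · rw [letterVal_true, toReduction, PresentedGroup.toGroup.of]; rfl

/-- In the quotient monoid by joinability the letters are invertible and satisfy the relators. So
the group maps to its units, and a word can be recovered from its group element up to joinability.
-/
theorem join_of_wordVal_eq (hT : IsTriangleSystem T) {l m : List (Bool × F)}
    (h : wordVal T l = wordVal T m) : Join (Reduces T) l m := by
  have h' := toReduction_wordVal hT l
  rw [h, toReduction_wordVal] at h'
  exact (Con.eq _).1 h'.symm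

theorem eq_of_irreducible (hT : IsTriangleSystem T) {l m : List (Bool × F)}
    (hl : ∀ k, ¬ Step T l k) (hm : ∀ k, ¬ Step T m k) (h : wordVal T l = wordVal T m) :
    l = m := by
  obtain ⟨d, h, h'⟩ := join_of_wordVal_eq hT h
  rcases h.cases_head with rfl | ⟨k, hk, _⟩
  · rcases h'.cases_head with rfl | ⟨k, hk, _⟩
    · rfl
    · exact absurd hk (hm k)
  · exact absurd hk (hl k)

theorem exists_irreducible_word (T : Set (F × F × F)) (l : List (Bool × F)) :
    ∃ m, wordVal T m = wordVal T l ∧ ∀ k, ¬ Step T m k := by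
  obtain ⟨m, hm, h⟩ := exists_irreducible weight (fun _ _ h => Step.weight_lt (T := T) h) l
  exact ⟨m, Reduces.wordVal_eq hm, h⟩

theorem not_step_nil (k : List (Bool × F)) : ¬ Step T [] k := nofun

theorem not_step_singleton (a : Bool × F) (k : List (Bool × F)) : ¬ Step T [a] k := by
  intro h
  cases h with | cons _ h => exact not_step_nil _ h

theorem of_injective (hT : IsTriangleSystem T) :
    Function.Injective (PresentedGroup.of : F → TriangleGroup T) := by
  intro s t h
  have := eq_of_irreducible hT (not_step_singleton (true, s)) (not_step_singleton (true, t))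
    (by simpa using h)
  simpa using this

/-- Compare normal forms of `s t = r⁻¹`. Either `s t` reduces to some `q⁻¹`, which forces `q = r`,
or it is irreducible of length two and cannot equal a single letter. -/
theorem mem_of_of_mul_of_mul_of_eq_one (hT : IsTriangleSystem T) {s t r : F}
    (h : (PresentedGroup.of s : TriangleGroup T) * PresentedGroup.of t * PresentedGroup.of r = 1) :
    (s, t, r) ∈ T := by
  have h' := eq_inv_of_mul_eq_one_left h
  by_cases hst : ∃ q, (s, t, q) ∈ T
  · obtain ⟨q, hq⟩ := hst
    rw [eq_inv_of_mul_eq_one_left (of_mul_of_mul_of hq), inv_inj] at h'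
    rwa [← of_injective hT h']
  · have := eq_of_irreducible hT (l := [(true, s), (true, t)]) (m := [(false, r)]) (fun k hk => by
      cases hk with
      | head hk => cases hk with | mul hk => exact hst ⟨_, hk⟩
      | cons _ hk => exact not_step_singleton _ _ hk) (not_step_singleton _) (by simpa using h')
    simp at this

end Rewriting


/-! ### Unitary matrices that leave the vector of a triangle presentation invariant -/

section Indicator

variable {F : Type*} [Fintype F] [DecidableEq F] {T : Set (F × F × F)}

open scoped Classical in
/-- The indicator function of `T`. -/
def ind (T : Set (F × F × F)) (a b c : F) : ℂ := if (a, b, c) ∈ T then 1 else 0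

theorem ind_of_mem {a b c : F} (h : (a, b, c) ∈ T) : ind T a b c = 1 := if_pos h

theorem ind_of_notMem {a b c : F} (h : (a, b, c) ∉ T) : ind T a b c = 0 := if_neg h

theorem star_ind (a b c : F) : star (ind T a b c) = ind T a b c := by
  unfold ind; split_ifs <;> simp

namespace IsTriangleSystem

variable (hT : IsTriangleSystem T)
include hT

theorem ind_cyc (a b c : F) : ind T a b c = ind T c a b := by
  by_cases h : (a, b, c) ∈ T
  · rw [ind_of_mem h, ind_of_mem (hT.cyc' h)]
  · rw [ind_of_notMem h, ind_of_notMem fun h' => h (hT.cyc h')]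

theorem sum_ind_third {a b c : F} (h : (a, b, c) ∈ T) {M : Type*} [AddCommMonoid M] [Module ℂ M]
    (f : F → M) : ∑ r, ind T a b r • f r = f c := by
  rw [Finset.sum_eq_single c, ind_of_mem h, one_smul]
  · exact fun r _ hr => by rw [ind_of_notMem fun h' => hr (hT.unique h' h), zero_smul]
  · simp

theorem sum_ind_first {a b c : F} (h : (a, b, c) ∈ T) {M : Type*} [AddCommMonoid M] [Module ℂ M]
    (f : F → M) : ∑ r, ind T r b c • f r = f a := by
  simpa only [hT.ind_cyc b c] using hT.sum_ind_third (hT.cyc h) f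

theorem sum_ind_mid {a b c : F} (h : (a, b, c) ∈ T) {M : Type*} [AddCommMonoid M] [Module ℂ M]
    (f : F → M) : ∑ r, ind T a r c • f r = f b := by
  simpa only [hT.ind_cyc c a, hT.ind_cyc _ c a] using hT.sum_ind_third (hT.cyc' h) f

end IsTriangleSystem

/-! ### The matrix of pairs of adjacent triangles and its square -/

/-- The number of pairs of adjacent triangles with the given outer edges. -/
def cross (T : Set (F × F × F)) (a b y z : F) : ℂ := ∑ w, ind T a w y * ind T b w z

open scoped Classical in
/-- The indicator function of the set of the pairs `(a, y)` with `(a, w, y) ∈ T` for some `w`. -/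
def inc (T : Set (F × F × F)) (a y : F) : ℂ := if ∃ w, (a, w, y) ∈ T then 1 else 0

namespace IsTriangleSystem

variable (hT : IsTriangleSystem T)
include hT

theorem sum_ind_eq_inc (a y : F) : ∑ w, ind T a w y = inc T a y := by
  by_cases h : ∃ w, (a, w, y) ∈ T
  · obtain ⟨w, hw⟩ := h
    rw [inc, if_pos ⟨w, hw⟩]
    simpa using hT.sum_ind_mid hw (fun _ => (1 : ℂ))
  · rw [inc, if_neg h]
    exact Finset.sum_eq_zero fun w _ => ind_of_notMem fun hw => h ⟨w, hw⟩

theorem cross_self_left (a y z : F) : cross T a a y z = if y = z then inc T a y else 0 := by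
  rw [cross]
  split_ifs with h
  · subst h
    rw [← hT.sum_ind_eq_inc]
    exact Finset.sum_congr rfl fun w _ => by unfold ind; split_ifs <;> simp
  · refine Finset.sum_eq_zero fun w _ => ?_
    by_cases hw : (a, w, y) ∈ T
    · rw [ind_of_notMem fun h' => h (hT.unique hw h'), mul_zero]
    · rw [ind_of_notMem hw, zero_mul]

theorem cross_self_right (a b y : F) : cross T a b y y = if a = b then inc T a y else 0 := by
  split_ifs with h
  · subst h
    rw [hT.cross_self_left, if_pos rfl]
  · refine Finset.sum_eq_zero fun w _ => ?_
    by_cases hw : (a, w, y) ∈ T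
    · rw [ind_of_notMem fun h' => h (hT.unique_left hw h'), mul_zero]
    · rw [ind_of_notMem hw, zero_mul]

/-- Here `inc T a y` tests whether the point `a` lies on the line of `y`, so the sum counts the
common lines of `a` and `d`. -/
theorem sum_inc_mul_inc {k : ℂ} (hk : ∀ a, ∑ y, inc T a y = k + 2) (a d : F) :
    ∑ y, inc T a y * inc T d y = if a = d then k + 2 else 1 := by
  split_ifs with h
  · subst h
    rw [← hk a]
    exact Finset.sum_congr rfl fun w _ => by unfold inc; split_ifs <;> simp
  · obtain ⟨y, w, v, h1, h2⟩ := hT.join h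
    rw [Finset.sum_eq_single y]
    · rw [inc, inc, if_pos ⟨w, hT.cyc h1⟩, if_pos ⟨v, hT.cyc h2⟩, one_mul]
    · intro y' _ hy'
      by_cases h3 : ∃ w, (a, w, y') ∈ T
      · by_cases h4 : ∃ w, (d, w, y') ∈ T
        · obtain ⟨w', h3⟩ := h3
          obtain ⟨v', h4⟩ := h4
          exact absurd ((hT.eq_or_eq (hT.cyc' h3) h1 (hT.cyc' h4) h2).resolve_right h) hy'
        · simp [inc, h4]
      · simp [inc, h3]
    · simp

/-- The lines of `a` and `b` meet in one point `w`, which determines `y` and `z`. These differ, and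
as points they lie on the line of `w` alone, so the column of `(y, z)` also has a single nonzero
entry. -/
theorem exists_cross_eq {a b : F} (hab : a ≠ b) :
    ∃ y z, (∀ y' z', cross T a b y' z' = if y' = y ∧ z' = z then 1 else 0) ∧
      ∀ d c, cross T d c y z = if d = a ∧ c = b then 1 else 0 := by
  obtain ⟨w, y, z, h1, h2⟩ := hT.meet hab
  have hyz : y ≠ z := by
    rintro rfl
    exact hab (hT.unique_left h1 h2)
  refine ⟨y, z, fun y' z' => ?_, fun d c => ?_⟩
  · rw [cross, Finset.sum_eq_single w]
    · split_ifs with h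
      · rw [h.1, h.2, ind_of_mem h1, ind_of_mem h2, one_mul]
      · by_cases h3 : (a, w, y') ∈ T
        · by_cases h4 : (b, w, z') ∈ T
          · exact absurd ⟨hT.unique h3 h1, hT.unique h4 h2⟩ h
          · rw [ind_of_notMem h4, mul_zero]
        · rw [ind_of_notMem h3, zero_mul]
    · intro w' _ hw'
      by_cases h3 : (a, w', y') ∈ T
      · by_cases h4 : (b, w', z') ∈ T
        · exact absurd ((hT.eq_or_eq h3 h4 h1 h2).resolve_left hab) hw'
        · rw [ind_of_notMem h4, mul_zero]
      · rw [ind_of_notMem h3, zero_mul]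
    · simp
  · rw [cross, Finset.sum_eq_single w]
    · split_ifs with h
      · rw [h.1, h.2, ind_of_mem h1, ind_of_mem h2, one_mul]
      · by_cases h3 : (d, w, y) ∈ T
        · by_cases h4 : (c, w, z) ∈ T
          · exact absurd ⟨hT.unique_left h3 h1, hT.unique_left h4 h2⟩ h
          · rw [ind_of_notMem h4, mul_zero]
        · rw [ind_of_notMem h3, zero_mul]
    · intro w' _ hw'
      by_cases h3 : (d, w', y) ∈ T
      · by_cases h4 : (c, w', z) ∈ T
        · exact absurd ((hT.eq_or_eq (hT.cyc h3) (hT.cyc h1) (hT.cyc h4)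
            (hT.cyc h2)).resolve_right hyz) hw'
        · rw [ind_of_notMem h4, mul_zero]
      · rw [ind_of_notMem h3, zero_mul]
    · simp

/-- The square of the matrix `cross T`. -/
theorem sum_cross_mul_cross {k : ℂ} (hk : ∀ a, ∑ y, inc T a y = k + 2) (a b d c : F) :
    ∑ y, ∑ z, cross T a b y z * cross T d c y z =
      (if a = b ∧ d = c then 1 else 0) + (if a = d ∧ b = c then 1 else 0) +
        if a = b ∧ a = d ∧ a = c then k else 0 := by
  -- On the diagonal `a = b` only `y = z` contributes and common lines are counted; off the diagonal
  -- each row has a single entry.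
  by_cases hab : a = b
  · subst hab
    simp only [hT.cross_self_left a, ite_mul, zero_mul, Finset.sum_ite_eq, Finset.mem_univ,
      if_true, hT.cross_self_right]
    by_cases hdc : d = c
    · subst hdc
      simp only [if_true, hT.sum_inc_mul_inc hk]
      by_cases had : a = d
      · simp [had]; ring
      · simp [had]
    · have : ¬ (a = d ∧ a = c) := fun h => hdc (h.1.symm.trans h.2)
      simp [hdc, this]
  · obtain ⟨y, z, h1, h2⟩ := hT.exists_cross_eq hab
    rw [Finset.sum_eq_single y, Finset.sum_eq_single z, h1, h2]
    · simp [hab, eq_comm]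
    · intro z' _ hz'
      simp [h1, hz']
    · simp
    · intro y' _ hy'
      exact Finset.sum_eq_zero fun z' _ => by simp [h1, hy']
    · simp

end IsTriangleSystem

/-- Lines have `order + 1` points, and points lie on as many lines by the cyclic symmetry of `T`.
Both counts are needed because reversal transposes `inc`. -/
theorem IsTrianglePresentation.exists_sum_inc {T : Set (F × F × F)}
    (hT : IsTrianglePresentation T) :
    ∃ k : ℂ, k ≠ 0 ∧ (∀ a, ∑ y, inc T a y = k + 2) ∧ ∀ a, ∑ y, inc T y a = k + 2 := by
  classical
  have hT' := hT.isTriangleSystem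
  obtain ⟨L, _, _, lam, h1, -, -⟩ := hT
  have hL : Finite L := Finite.of_equiv F lam
  have key : ∀ a, ∑ y, inc T y a = (Configuration.ProjectivePlane.order F L : ℂ) + 1 := by
    intro a
    have h := Configuration.ProjectivePlane.pointCount_eq F (lam a)
    rw [Configuration.pointCount, Nat.card_eq_fintype_card, Fintype.card_subtype,
      Finset.card_filter] at h
    rw [← Nat.cast_one, ← Nat.cast_add, ← h, Nat.cast_sum]
    refine Finset.sum_congr rfl fun y _ => ?_
    rw [inc, Nat.cast_ite, Nat.cast_one, Nat.cast_zero]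
    exact if_congr (Iff.trans ⟨fun ⟨w, h⟩ => ⟨w, hT'.cyc' h⟩, fun ⟨w, h⟩ => ⟨w, hT'.cyc h⟩⟩
      (h1 a y)) rfl rfl
  -- This constant multiplies the diagonal projection in the square of `cross T`. It is nonzero
  -- because a projective plane has order greater than `1`.
  refine ⟨(Configuration.ProjectivePlane.order F L : ℂ) - 1, ?_, fun a => ?_, fun a => ?_⟩
  · rw [sub_ne_zero]
    exact_mod_cast (Configuration.ProjectivePlane.one_lt_order F L).ne'
  · have h : ∑ y, inc T a y = ∑ y, inc T y a := by
      simp only [← hT'.sum_ind_eq_inc, hT'.ind_cyc a, hT'.ind_cyc _ a]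
      exact Finset.sum_comm
    rw [h, key]; ring
  · rw [key]; ring

end Indicator

/-! ### Intertwiners and orthogonality of the entries -/

/-- The matrix `U` and its conjugate are unitary, and the indicator function of `T` is invariant
under the threefold tensor power of `U`. -/
structure IsTriangleMatrix {F : Type*} [Fintype F] [DecidableEq F] {A : Type*} [Ring A]
    [StarRing A] [Algebra ℂ A] (T : Set (F × F × F)) (U : F → F → A) : Prop where
  unitary : IsUnitaryMatrix U
  conj : IsUnitaryMatrix (fun s t => star (U s t))
  sum_eq : ∀ a b c, ∑ p, ∑ q, ∑ r, ind T p q r • (U a p * (U b q * U c r)) = ind T a b c • 1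

section Matrix

variable {F : Type*} [Fintype F] [DecidableEq F] {T : Set (F × F × F)} {A : Type*} [Ring A]

/-- Contracts the inner pair of factors when two triangle relations are multiplied along a shared
edge `w`. -/
theorem sum_mul_sum_of_orthogonal {f g : F → F → A}
    (h : ∀ q q', ∑ w, f w q * g w q' = if q = q' then 1 else 0) (y z : F → A) :
    ∑ w, (∑ q, y q * f w q) * ∑ q, g w q * z q = ∑ q, y q * z q := by
  calc ∑ w, (∑ q, y q * f w q) * ∑ q, g w q * z q
      = ∑ q, ∑ q', y q * (∑ w, f w q * g w q') * z q' := by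
        simp only [Finset.mul_sum, Finset.sum_mul, mul_assoc]
        rw [sum_rot3]
        exact Finset.sum_congr rfl fun _ _ => Finset.sum_comm
    _ = _ := by simp [h]

variable [StarRing A] [Algebra ℂ A]

theorem sum_smul_mul_sum_smul (c d : F → F → ℂ) (f g : F → A) :
    ∑ w, (∑ a, c w a • f a) * ∑ b, d w b • g b =
      ∑ a, ∑ b, (∑ w, c w a * d w b) • (f a * g b) := by
  simp only [Finset.sum_mul_sum, smul_mul_smul_comm, Finset.sum_smul]
  rw [Finset.sum_comm]
  exact Finset.sum_congr rfl fun _ _ => Finset.sum_comm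

namespace IsTriangleMatrix

variable {U : F → F → A} (hU : IsTriangleMatrix T U)
include hU

/-- The invariance equation with its first factor moved to the other side by unitarity: `ξ_T`, read
as a map, intertwines `U ⊗ U` and `Ū`. -/
theorem sum_mul (p b c : F) :
    ∑ q, ∑ r, ind T p q r • (U b q * U c r) = ∑ a, ind T a b c • star (U a p) := by
  calc ∑ q, ∑ r, ind T p q r • (U b q * U c r)
      = ∑ p', (∑ a, star (U a p) * U a p') * ∑ q, ∑ r, ind T p' q r • (U b q * U c r) := by
        simp [hU.unitary.2]
    _ = ∑ a, star (U a p) * ∑ p', ∑ q, ∑ r, ind T p' q r • (U a p' * (U b q * U c r)) := by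
        simp only [Finset.sum_mul]
        rw [Finset.sum_comm]
        simp only [Finset.mul_sum, mul_smul_comm, mul_assoc]
    _ = _ := by simp [hU.sum_eq]

variable [StarModule ℂ A]

theorem sum_star_mul_star (p b c : F) :
    ∑ q, ∑ r, ind T p q r • (star (U c r) * star (U b q)) = ∑ a, ind T a b c • U a p := by
  have h := congrArg star (hU.sum_mul p b c)
  simpa only [star_sum, star_smul, star_mul, star_star, star_ind] using h

theorem reverse :
    IsTriangleMatrix {p : F × F × F | (p.2.2, p.2.1, p.1) ∈ T} (fun s t => star (U s t)) where
  unitary := hU.conj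
  conj := by simpa only [star_star] using hU.unitary
  sum_eq a b c := by
    have h := congrArg star (hU.sum_eq c b a)
    simp only [star_sum, star_smul, star_mul, star_ind, star_one, mul_assoc] at h
    refine Eq.trans ?_ h
    rw [sum_rot3]
    refine Finset.sum_congr rfl fun p _ => ?_
    rw [Finset.sum_comm]
    rfl

/-- Expand each of the two factors `∑ ind • U` and `∑ ind • star U` by a triangle relation. The
inner factors `star (U w q) * U w q'` then sum over `w` to a delta. As an operator, `cross T`
intertwines `U ⊗ Ū` with `Ū ⊗ U`. -/
theorem sum_cross (s t y z : F) :
    ∑ a, ∑ b, cross T a b y z • (U a s * star (U b t)) =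
      ∑ c, ∑ d, cross T s t c d • (star (U y c) * U z d) := by
  calc ∑ a, ∑ b, cross T a b y z • (U a s * star (U b t))
      = ∑ w, (∑ a, ind T a w y • U a s) * ∑ b, ind T b w z • star (U b t) :=
        (sum_smul_mul_sum_smul (fun w a => ind T a w y) (fun w b => ind T b w z) _ _).symm
    _ = ∑ w, (∑ q, (∑ r, ind T s q r • star (U y r)) * star (U w q)) *
          ∑ q, U w q * ∑ r, ind T t q r • U z r := by
        simp only [← hU.sum_star_mul_star, ← hU.sum_mul, Finset.sum_mul, Finset.mul_sum,
          smul_mul_assoc, mul_smul_comm]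
    _ = ∑ q, (∑ r, ind T s q r • star (U y r)) * ∑ r, ind T t q r • U z r :=
        sum_mul_sum_of_orthogonal hU.unitary.2 _ _
    _ = _ := sum_smul_mul_sum_smul (fun q r => ind T s q r) (fun q r => ind T t q r) _ _

/-- The intertwining relation for the transpose of `cross T`, obtained by contracting along rotated
triangles. -/
theorem sum_cross' (hT : IsTriangleSystem T) (a b s t : F) :
    ∑ y, ∑ z, cross T a b y z • (star (U y s) * U z t) =
      ∑ c, ∑ d, cross T c d s t • (U a c * star (U b d)) := by
  calc ∑ y, ∑ z, cross T a b y z • (star (U y s) * U z t)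
      = ∑ w, (∑ y, ind T a w y • star (U y s)) * ∑ z, ind T b w z • U z t :=
        (sum_smul_mul_sum_smul (fun w y => ind T a w y) (fun w z => ind T b w z) _ _).symm
    _ = ∑ w, (∑ r, (∑ q, ind T s q r • U a q) * U w r) *
          ∑ r, star (U w r) * ∑ q, ind T t q r • star (U b q) := by
        refine Finset.sum_congr rfl fun w _ => congrArg₂ _ ?_ ?_
        · simp only [hT.ind_cyc a w, ← hU.sum_mul, Finset.sum_mul, smul_mul_assoc]
          exact Finset.sum_comm
        · simp only [hT.ind_cyc b w, ← hU.sum_star_mul_star, Finset.mul_sum, mul_smul_comm]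
          exact Finset.sum_comm
    _ = ∑ r, (∑ q, ind T s q r • U a q) * ∑ q, ind T t q r • star (U b q) :=
        sum_mul_sum_of_orthogonal (by simpa only [star_star] using hU.conj.2) _ _
    _ = _ := by
        refine (sum_smul_mul_sum_smul (fun r q => ind T s q r) (fun r q => ind T t q r)
          _ _).trans ?_
        simp only [cross, hT.ind_cyc _ _ s, hT.ind_cyc _ _ t]

/-- Composing the two intertwiners gives an operator that commutes with `U ⊗ Ū`. -/
theorem sum_square (hT : IsTriangleSystem T) (a b s t : F) :
    ∑ d, ∑ c, (∑ y, ∑ z, cross T a b y z * cross T d c y z) • (U d s * star (U c t)) =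
      ∑ d, ∑ c, (∑ y, ∑ z, cross T s t y z * cross T d c y z) • (U a d * star (U b c)) := by
  calc _ = ∑ y, ∑ z, cross T a b y z • ∑ d, ∑ c, cross T d c y z • (U d s * star (U c t)) := by
        simp only [Finset.sum_smul, Finset.smul_sum, smul_smul]
        rw [sum_rot4, sum_rot4]
    _ = ∑ y, ∑ z, cross T a b y z •
          ∑ y', ∑ z', cross T s t y' z' • (star (U y y') * U z z') := by
        simp only [hU.sum_cross]
    _ = ∑ y', ∑ z', cross T s t y' z' •
          ∑ y, ∑ z, cross T a b y z • (star (U y y') * U z z') := by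
        simp only [Finset.smul_sum]
        rw [sum_rot4, sum_rot4]
        exact Finset.sum_congr rfl fun _ _ => Finset.sum_congr rfl fun _ _ =>
          Finset.sum_congr rfl fun _ _ => Finset.sum_congr rfl fun _ _ => smul_comm _ _ _
    _ = ∑ y', ∑ z', cross T s t y' z' •
          ∑ d, ∑ c, cross T d c y' z' • (U a d * star (U b c)) := by
        simp only [hU.sum_cross' hT]
    _ = _ := by
        simp only [Finset.sum_smul, Finset.smul_sum, smul_smul]
        rw [sum_rot4, sum_rot4]

/-- The two ways in which the products `U a s * star (U b t)` can be orthogonal coincide. -/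
theorem smul_mul_star (hT : IsTriangleSystem T) {k : ℂ} (hk : ∀ a, ∑ y, inc T a y = k + 2)
    (a b s t : F) :
    (if a = b then k else 0) • (U a s * star (U a t)) =
      (if s = t then k else 0) • (U a s * star (U b s)) := by
  have key : ∀ (a b : F) (f : F → F → A),
      ∑ d, ∑ c, (∑ y, ∑ z, cross T a b y z * cross T d c y z) • f d c =
        (if a = b then ∑ c, f c c else 0) + f a b + (if a = b then k else 0) • f a a := by
    intro a b f
    simp only [hT.sum_cross_mul_cross hk, add_smul, Finset.sum_add_distrib]
    congr 1
    · congr 1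
      · by_cases h : a = b <;> simp [h, ite_smul]
      · rw [Finset.sum_eq_single a, Finset.sum_eq_single b]
        · simp
        · intro c _ hc
          simp [hc.symm]
        · simp
        · intro d _ hd
          simp [hd.symm]
        · simp
    · by_cases h : a = b
      · rw [Finset.sum_eq_single a, Finset.sum_eq_single a]
        · simp [h]
        · intro c _ hc
          simp [hc.symm]
        · simp
        · intro d _ hd
          simp [hd.symm]
        · simp
      · simp [h]
  have h := hU.sum_square hT a b s t
  rw [key, key] at h
  -- By unitarity of `Ū` and of `U`, the rank one terms on both sides agree. The identity terms
  -- agree as well, so only the multiples of the diagonal projection remain.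
  have h1 : ∑ c, U c s * star (U c t) = if s = t then 1 else 0 := by
    simpa only [star_star] using hU.conj.2 s t
  rw [h1, hU.unitary.1 a b] at h
  by_cases hab : a = b
  · by_cases hst : s = t
    · simp [hab, hst]
    · simpa [hab, hst] using h
  · by_cases hst : s = t
    · rw [if_neg hab, if_pos hst, zero_smul, eq_comm]
      simpa [hab, hst] using h
    · simp [hab, hst]

theorem mul_star_of_ne_right (hT : IsTriangleSystem T) {k : ℂ} (hk0 : k ≠ 0)
    (hk : ∀ a, ∑ y, inc T a y = k + 2) (a : F) {s t : F} (hst : s ≠ t) :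
    U a s * star (U a t) = 0 := by
  have h := hU.smul_mul_star hT hk a a s t
  rw [if_pos rfl, if_neg hst, zero_smul] at h
  simpa [hk0, smul_smul] using congrArg (k⁻¹ • ·) h

theorem mul_star_of_ne_left (hT : IsTriangleSystem T) {k : ℂ} (hk0 : k ≠ 0)
    (hk : ∀ a, ∑ y, inc T a y = k + 2) {a b : F} (hab : a ≠ b) (s : F) :
    U a s * star (U b s) = 0 := by
  have h := hU.smul_mul_star hT hk a b s s
  rw [if_pos rfl, if_neg hab, zero_smul] at h
  simpa [hk0, smul_smul] using congrArg (k⁻¹ • ·) h.symm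

end IsTriangleMatrix

end Matrix


/-! ### Matrices of partial isometries -/

/-- The entries of `U` in one row or in one column are partial isometries with orthogonal initial
projections and orthogonal final projections. -/
structure HasOrthogonalEntries {F : Type*} {A : Type*} [Ring A] [StarRing A] (U : F → F → A) :
    Prop where
  row : ∀ (a : F) {s t : F}, s ≠ t → U a s * star (U a t) = 0
  col : ∀ {a b : F} (_ : a ≠ b) (s : F), U a s * star (U b s) = 0
  star_row : ∀ (a : F) {s t : F}, s ≠ t → star (U a s) * U a t = 0
  star_col : ∀ {a b : F} (_ : a ≠ b) (s : F), star (U a s) * U b s = 0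

/-- The sign that is encoded by a truth value. -/
def sgn (b : Bool) : ℤˣ := if b then 1 else -1

section Matrix

variable {F : Type*} [Fintype F] [DecidableEq F] {T : Set (F × F × F)} {A : Type*} [Ring A]
  [StarRing A] [Algebra ℂ A] [StarModule ℂ A] {U : F → F → A}

namespace HasOrthogonalEntries

variable (hO : HasOrthogonalEntries U)
include hO

/-- Multiply `∑ k, U a k * star (U a k) = 1` by `U a s` on the right; only `k = s` survives. So the
entries are partial isometries. -/
theorem mul_star_mul_self (hU : IsUnitaryMatrix U) (a s : F) :
    U a s * star (U a s) * U a s = U a s := by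
  calc U a s * star (U a s) * U a s = ∑ k, U a k * star (U a k) * U a s := by
        rw [Finset.sum_eq_single s]
        · exact fun k _ hk => by rw [mul_assoc, hO.star_row a hk, mul_zero]
        · simp
    _ = _ := by rw [← Finset.sum_mul, hU.1, if_pos rfl, one_mul]

theorem mul_star_mul_sum_row (hU : IsUnitaryMatrix U) (a s : F) (z : F → A) :
    U a s * star (U a s) * ∑ q, U a q * z q = U a s * z s := by
  rw [Finset.mul_sum, Finset.sum_eq_single s]
  · rw [← mul_assoc, hO.mul_star_mul_self hU]
  · intro q _ hq
    rw [mul_assoc, ← mul_assoc (star _), hO.star_row a hq.symm, zero_mul, mul_zero]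
  · simp

theorem mul_star_mul_sum_col (hU : IsUnitaryMatrix U) (a s : F) (z : F → A) :
    U a s * star (U a s) * ∑ q, U q s * z q = U a s * z a := by
  rw [Finset.mul_sum, Finset.sum_eq_single a]
  · rw [← mul_assoc, hO.mul_star_mul_self hU]
  · intro q _ hq
    rw [mul_assoc, ← mul_assoc (star _), hO.star_col hq.symm, zero_mul, mul_zero]
  · simp

end HasOrthogonalEntries

namespace IsTriangleMatrix

variable (hU : IsTriangleMatrix T U)
include hU

theorem sum_mul_col (a b r : F) :
    ∑ s, ∑ t, ind T s t r • (U s a * U t b) = ∑ c, ind T a b c • star (U r c) := by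
  calc ∑ s, ∑ t, ind T s t r • (U s a * U t b)
      = ∑ t, (∑ s, ind T s t r • U s a) * U t b := by
        simp only [Finset.sum_mul, smul_mul_assoc]
        exact Finset.sum_comm
    _ = ∑ t, (∑ q, (∑ c, ind T a q c • star (U r c)) * star (U t q)) *
          ∑ q, U t q * if q = b then 1 else 0 := by
        simp only [← hU.sum_star_mul_star, Finset.sum_mul, smul_mul_assoc, mul_ite, mul_one,
          mul_zero, Finset.sum_ite_eq', Finset.mem_univ, if_true]
    _ = ∑ q, (∑ c, ind T a q c • star (U r c)) * if q = b then 1 else 0 :=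
        sum_mul_sum_of_orthogonal hU.unitary.2 _ _
    _ = _ := by simp

/-- The statements with the adjoint on the left are those for the reversed triangle presentation and
the conjugate matrix. -/
theorem hasOrthogonalEntries (hT : IsTrianglePresentation T) : HasOrthogonalEntries U := by
  obtain ⟨k, hk0, hk, hk'⟩ := hT.exists_sum_inc
  have hT' := hT.isTriangleSystem
  -- For the reversed system `inc` is transposed by definition.
  have hk'' : ∀ a, ∑ y, inc {p : F × F × F | (p.2.2, p.2.1, p.1) ∈ T} a y = k + 2 := hk'
  refine ⟨fun a _ _ h => hU.mul_star_of_ne_right hT' hk0 hk a h,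
    fun h s => hU.mul_star_of_ne_left hT' hk0 hk h s, fun a _ _ h => ?_, fun h s => ?_⟩
  · simpa using hU.reverse.mul_star_of_ne_right hT'.reverse hk0 hk'' a h
  · simpa using hU.reverse.mul_star_of_ne_left hT'.reverse hk0 hk'' h s

variable (hO : HasOrthogonalEntries U) (hT : IsTriangleSystem T)
include hO hT

/-- In `sum_mul_col` the right side vanishes. The final projection of `U s a` isolates the summand
with first index `s`, whose second index must be `t`. -/
theorem mul_eq_zero_of_left {s t r a b : F} (h : (s, t, r) ∈ T) (hab : ∀ c, (a, b, c) ∉ T) :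
    U s a * U t b = 0 := by
  have e := hU.sum_mul_col a b r
  simp only [fun c => ind_of_notMem (hab c), zero_smul, Finset.sum_const_zero] at e
  have e' := hO.mul_star_mul_sum_col hU.unitary s a fun s => ∑ t, ind T s t r • U t b
  rw [hT.sum_ind_mid h] at e'
  simp only [Finset.mul_sum (Finset.univ : Finset F) (fun t => ind T _ t r • U t b),
    mul_smul_comm, e, mul_zero] at e'
  exact e'.symm

/-- The final projection of `U s a` cuts out one summand of the relation `sum_mul` for `c`. -/
theorem mul_eq_of_mem {a b c : F} (h : (a, b, c) ∈ T) (s t : F) :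
    U s a * U t b = U s a * star (U s a) * ∑ r, ind T r s t • star (U r c) := by
  have e' := hO.mul_star_mul_sum_row hU.unitary s a fun q => ∑ r, ind T c q r • U t r
  rw [hT.sum_ind_third (hT.cyc' h)] at e'
  rw [← e', ← hU.sum_mul c s t]
  simp only [Finset.mul_sum (Finset.univ : Finset F) (fun r => ind T c _ r • U t r),
    mul_smul_comm]

theorem mul_eq_zero_of_right {s t a b c : F} (h : (a, b, c) ∈ T) (hst : ∀ r, (s, t, r) ∉ T) :
    U s a * U t b = 0 := by
  rw [hU.mul_eq_of_mem hO hT h, Finset.sum_eq_zero, mul_zero]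
  exact fun r _ => by rw [ind_of_notMem fun h' => hst r (hT.cyc h'), zero_smul]

/-- If `a b` closes up with some `c' ≠ c`, then `U s a * U t b` ends in `star (U r c')`, which is
orthogonal to `U r c` in the same row. -/
theorem mul_mul_eq_zero {s t r a b c : F} (h : (s, t, r) ∈ T) (habc : (a, b, c) ∉ T) :
    U s a * (U t b * U r c) = 0 := by
  rw [← mul_assoc]
  by_cases hab : ∃ c', (a, b, c') ∈ T
  · obtain ⟨c', hc'⟩ := hab
    have hc : c' ≠ c := by
      rintro rfl
      exact habc hc'
    rw [hU.mul_eq_of_mem hO hT hc', hT.sum_ind_first (hT.cyc' h), mul_assoc, hO.star_row r hc,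
      mul_zero]
  · rw [hU.mul_eq_zero_of_left hO hT h (not_exists.1 hab), zero_mul]

/-- No coefficient leads from an irreducible pair of letters to a reducible pair with the same
signs. This connects the rewriting system with the orthogonality relations. -/
theorem signed_mul_signed {a b a' b' : Bool × F} {r : List (Bool × F)} (h : Rule T a' b' r)
    (ha : a.1 = a'.1) (hb : b.1 = b'.1) (hab : ∀ r, ¬ Rule T a b r) :
    signed U (sgn a.1) a.2 a'.2 * signed U (sgn b.1) b.2 b'.2 = 0 := by
  obtain ⟨ea, a⟩ := a
  obtain ⟨eb, b⟩ := b
  -- A positive letter followed by an inverse is never irreducible, so two of the rules need no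
  -- orthogonality.
  have hright : ea = true → eb = false → False := by
    rintro rfl rfl
    by_cases h : a = b
    · subst h
      exact hab _ (.cancel_right a)
    · obtain ⟨w, u, v, h1, h2⟩ := hT.meet h
      exact hab _ (.swap h h1 h2)
  cases h with
  | cancel_right s => exact (hright ha hb).elim
  | swap => exact (hright ha hb).elim
  | cancel_left s =>
    obtain rfl : ea = false := ha
    obtain rfl : eb = true := hb
    have h : a ≠ b := by
      rintro rfl
      exact hab _ (.cancel_left a)
    simpa [sgn, signed] using hO.star_col h s
  | mul h =>
    obtain rfl : ea = true := ha
    obtain rfl : eb = true := hb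
    simpa [sgn, signed] using
      hU.mul_eq_zero_of_right hO hT h fun r hr => hab _ (.mul hr)
  | mul_inv h =>
    obtain rfl : ea = false := ha
    obtain rfl : eb = false := hb
    simpa [sgn, signed] using congrArg star
      (hU.mul_eq_zero_of_right hO hT h fun r hr => hab _ (.mul_inv hr))

/-- At the position of a reducible pair of the word of `t`, the word of `s` has an irreducible pair,
so two adjacent factors multiply to zero. -/
theorem tensorCoeff_eq_zero {n : ℕ} (ε : Fin n → Bool) (s t : Fin n → F)
    (hs : ∀ k, ¬ Step T (List.ofFn fun i => (ε i, s i)) k) {l : List (Bool × F)}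
    (ht : Step T (List.ofFn fun i => (ε i, t i)) l) :
    tensorCoeff (signed U) (fun i => sgn (ε i)) s t = 0 := by
  induction n generalizing l with
  | zero => exact absurd ht (by simpa using not_step_nil l)
  | succ n ih =>
    rw [tensorCoeff_succ]
    rw [List.ofFn_succ] at ht
    simp only [List.ofFn_succ (f := fun i => (ε i, s i))] at hs
    generalize hm : (List.ofFn fun i : Fin n => (ε i.succ, t i.succ)) = m at ht
    cases ht with
    | cons _ h =>
      subst hm
      rw [ih _ _ _ (fun k hk => hs _ (.cons _ hk)) h, mul_zero]
    | @head _ b r h m =>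
      cases n with
      | zero => simp at hm
      | succ n =>
        rw [List.ofFn_succ, List.cons.injEq] at hm
        obtain ⟨rfl, rfl⟩ := hm
        rw [tensorCoeff_succ, ← mul_assoc]
        have := hU.signed_mul_signed hO hT h (a := (ε 0, s 0)) (b := (ε (Fin.succ 0), s (Fin.succ 0)))
          rfl rfl fun r hr => by
            simp only [List.ofFn_succ] at hs
            exact hs _ (.head hr _)
        rw [this, zero_mul]

end IsTriangleMatrix

/-! ### The coaction on the group algebra -/

theorem single_one_sum {ι G : Type*} [Monoid G] (s : Finset ι) (f : ι → A) :
    MonoidAlgebra.single (1 : G) (∑ i ∈ s, f i) = ∑ i ∈ s, MonoidAlgebra.single 1 (f i) :=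
  map_sum (MonoidAlgebra.singleAddHom (1 : G)) f s

/-- The image of a letter under the coaction on the group algebra of the triangle group. -/
def letterSum (T : Set (F × F × F)) (U : F → F → A) (a : Bool × F) :
    MonoidAlgebra A (TriangleGroup T) :=
  ∑ t, MonoidAlgebra.single (letterVal T (a.1, t)) (signed U (sgn a.1) a.2 t)

theorem prod_letterSum {n : ℕ} (ε : Fin n → Bool) (s : Fin n → F) :
    (List.ofFn fun i => letterSum T U (ε i, s i)).prod =
      ∑ t : Fin n → F, MonoidAlgebra.single (wordVal T (List.ofFn fun i => (ε i, t i)))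
        (tensorCoeff (signed U) (fun i => sgn (ε i)) s t) := by
  induction n with
  | zero => simp [tensorCoeff_zero, MonoidAlgebra.one_def]
  | succ n ih =>
    rw [List.ofFn_succ, List.prod_cons, ih]
    simp only [List.ofFn_succ, wordVal_cons, tensorCoeff_succ]
    rw [sum_cons (fun a (t : Fin n → F) => MonoidAlgebra.single
      (letterVal T (ε 0, a) * wordVal T (List.ofFn fun i => (ε i.succ, t i)))
      (signed U (sgn (ε 0)) (s 0) a *
        tensorCoeff (signed U) (fun i => sgn (ε i.succ)) (fun i => s i.succ) t))]
    simp only [letterSum, Finset.sum_mul_sum, MonoidAlgebra.single_mul_single]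

namespace IsTriangleMatrix


/-- The image of a generator under the coaction as an invertible element. -/
def generatorUnit (hU : IsTriangleMatrix T U) (hO : HasOrthogonalEntries U) (s : F) :
    (MonoidAlgebra A (TriangleGroup T))ˣ where
  val := letterSum T U (true, s)
  inv := letterSum T U (false, s)
  val_inv := by
    have : ∀ a, ∑ b, MonoidAlgebra.single
        ((PresentedGroup.of a : TriangleGroup T) * (PresentedGroup.of b)⁻¹)
        (U s a * star (U s b)) = MonoidAlgebra.single 1 (U s a * star (U s a)) := by
      intro a
      rw [Finset.sum_eq_single a]
      · rw [mul_inv_cancel]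
      · exact fun b _ hb => by rw [hO.row s hb.symm, MonoidAlgebra.single_zero]
      · simp
    simp only [letterSum, Finset.sum_mul_sum, MonoidAlgebra.single_mul_single, sgn, if_true,
      signed_one, Bool.false_eq_true, if_false, signed_neg_one, letterVal_true, letterVal_false,
      this]
    rw [← single_one_sum, hU.unitary.1, if_pos rfl, MonoidAlgebra.one_def]
  inv_val := by
    have : ∀ a, ∑ b, MonoidAlgebra.single
        ((PresentedGroup.of a : TriangleGroup T)⁻¹ * (PresentedGroup.of b))
        (star (U s a) * U s b) = MonoidAlgebra.single 1 (star (U s a) * U s a) := by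
      intro a
      rw [Finset.sum_eq_single a]
      · rw [inv_mul_cancel]
      · exact fun b _ hb => by rw [hO.star_row s hb.symm, MonoidAlgebra.single_zero]
      · simp
    simp only [letterSum, Finset.sum_mul_sum, MonoidAlgebra.single_mul_single, sgn, if_true,
      signed_one, Bool.false_eq_true, if_false, signed_neg_one, letterVal_true, letterVal_false,
      this]
    have h := hU.conj.1 s s
    simp only [star_star, if_true] at h
    rw [← single_one_sum, h, MonoidAlgebra.one_def]

/-- The coaction as a homomorphism on the triangle group. -/
def coaction (hU : IsTriangleMatrix T U) (hO : HasOrthogonalEntries U)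
    (hT : IsTriangleSystem T) : TriangleGroup T →* (MonoidAlgebra A (TriangleGroup T))ˣ :=
  PresentedGroup.toGroup (f := hU.generatorUnit hO) (by
    rintro _ ⟨s, t, r, h, rfl⟩
    simp only [map_mul, FreeGroup.lift_apply_of]
    refine Units.ext ?_
    -- Terms outside `T` vanish, and those in `T` sit at the identity of the group. The relator is
    -- therefore sent to the invariance equation at `(s, t, r)`.
    have key : ∀ a b c, MonoidAlgebra.single ((PresentedGroup.of a : TriangleGroup T) *
        (PresentedGroup.of b * PresentedGroup.of c)) (U s a * (U t b * U r c)) =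
        MonoidAlgebra.single 1 (ind T a b c • (U s a * (U t b * U r c))) := by
      intro a b c
      by_cases habc : (a, b, c) ∈ T
      · rw [ind_of_mem habc, one_smul, ← mul_assoc, of_mul_of_mul_of habc]
      · rw [hU.mul_mul_eq_zero hO hT h habc, smul_zero, MonoidAlgebra.single_zero,
          MonoidAlgebra.single_zero]
    simp only [Units.val_mul, Units.val_one, generatorUnit, letterSum, sgn, if_true, signed_one,
      letterVal_true, mul_assoc]
    simp only [Finset.sum_mul, Finset.mul_sum, MonoidAlgebra.single_mul_single, key]
    rw [sum_rot3, Finset.sum_congr rfl fun _ _ => Finset.sum_comm]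
    simp only [← single_one_sum]
    rw [MonoidAlgebra.one_def, hU.sum_eq s t r, ind_of_mem h, one_smul])

theorem coaction_wordVal (hU : IsTriangleMatrix T U) (hO : HasOrthogonalEntries U)
    (hT : IsTriangleSystem T) (l : List (Bool × F)) :
    (hU.coaction hO hT (wordVal T l) : MonoidAlgebra A (TriangleGroup T)) =
      (l.map (letterSum T U)).prod := by
  induction l with
  | nil => simp
  | cons a l ih =>
    rw [wordVal_cons, map_mul, Units.val_mul, ih, List.map_cons, List.prod_cons]
    congr 1
    rcases a with ⟨_ | _, s⟩
    · rw [letterVal_false, map_inv, coaction, PresentedGroup.toGroup.of]; rfl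
    · rw [letterVal_true, coaction, PresentedGroup.toGroup.of]; rfl

open scoped Classical in
theorem coeff_coaction_ofFn (hU : IsTriangleMatrix T U) (hO : HasOrthogonalEntries U)
    (hT : IsTriangleSystem T) {n : ℕ} (ε : Fin n → Bool) (s : Fin n → F) :
    (hU.coaction hO hT (wordVal T (List.ofFn fun i => (ε i, s i))) :
      MonoidAlgebra A (TriangleGroup T)).coeff 1 =
      ∑ t : Fin n → F, if wordVal T (List.ofFn fun i => (ε i, t i)) = 1 then
        tensorCoeff (signed U) (fun i => sgn (ε i)) s t else 0 := by
  have h : (List.ofFn fun i => (ε i, s i)).map (letterSum T U) =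
      List.ofFn fun i => letterSum T U (ε i, s i) := List.map_ofFn
  rw [coaction_wordVal, h, prod_letterSum, MonoidAlgebra.coeff_sum, Finsupp.finsetSum_apply]
  exact Finset.sum_congr rfl fun t _ => by
    rw [MonoidAlgebra.coeff_single, Finsupp.single_apply]

/-- The coaction depends only on the group element, so an irreducible representative can be expanded
instead of the given word. -/
theorem coeff_coaction_of_ne_one (hU : IsTriangleMatrix T U) (hO : HasOrthogonalEntries U)
    (hT : IsTriangleSystem T) {l : List (Bool × F)} (hl : wordVal T l ≠ 1) :
    (hU.coaction hO hT (wordVal T l) : MonoidAlgebra A (TriangleGroup T)).coeff 1 = 0 := by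
  obtain ⟨m, hm, hirr⟩ := exists_irreducible_word T l
  obtain ⟨n, f, rfl⟩ : ∃ n, ∃ f : Fin n → Bool × F, m = List.ofFn f :=
    ⟨m.length, m.get, (List.ofFn_get m).symm⟩
  rw [← hm] at hl ⊢
  have h := hU.coeff_coaction_ofFn hO hT (fun i => (f i).1) (fun i => (f i).2)
  refine h.trans (Finset.sum_eq_zero fun t _ => ?_)
  split_ifs with ht
  -- A reducible target word has coefficient zero. An irreducible trivial target is empty, which
  -- would make the source word empty and hence trivial.
  · by_cases hirr' : ∃ k, Step T (List.ofFn fun i => ((f i).1, t i)) k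
    · obtain ⟨k, hk⟩ := hirr'
      exact hU.tensorCoeff_eq_zero hO hT _ _ _ hirr hk
    · have h0 := eq_of_irreducible hT (not_exists.1 hirr') not_step_nil (ht.trans wordVal_nil.symm)
      obtain rfl : n = 0 := by simpa using congrArg List.length h0
      simp at hl
  · rfl

open scoped Classical in
-- Both sides are the coefficient at the identity of the coaction applied to the word of `s`.
theorem sum_tensorCoeff (hU : IsTriangleMatrix T U) (hO : HasOrthogonalEntries U)
    (hT : IsTriangleSystem T) {n : ℕ} (ε : Fin n → Bool) (s : Fin n → F) :
    (∑ t : Fin n → F, if wordVal T (List.ofFn fun i => (ε i, t i)) = 1 then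
        tensorCoeff (signed U) (fun i => sgn (ε i)) s t else 0) =
      if wordVal T (List.ofFn fun i => (ε i, s i)) = 1 then 1 else 0 := by
  rw [← hU.coeff_coaction_ofFn hO hT]
  split_ifs with h
  · rw [h, (hU.coaction hO hT).map_one, Units.val_one, MonoidAlgebra.one_def,
      MonoidAlgebra.coeff_single, Finsupp.single_eq_same]
  · exact hU.coeff_coaction_of_ne_one hO hT h

theorem isInvariant_xi (hU : IsTriangleMatrix T U) (hT : IsTrianglePresentation T) {n : ℕ}
    (ε : Fin n → ℤˣ) :
    IsInvariant U ε (xi (PresentedGroup.of : F → TriangleGroup T) ε) := by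
  classical
  obtain ⟨b, rfl⟩ : ∃ b : Fin n → Bool, ε = fun i => sgn (b i) := by
    refine ⟨fun i => decide (ε i = 1), funext fun i => ?_⟩
    rcases Int.units_eq_one_or (ε i) with h | h <;> simp [sgn, h]
  have hxi : ∀ s, xi (PresentedGroup.of : F → TriangleGroup T) (fun i => sgn (b i)) s =
      if wordVal T (List.ofFn fun i => (b i, s i)) = 1 then 1 else 0 := by
    intro s
    have : (fun i => (PresentedGroup.of (s i) : TriangleGroup T) ^ ((sgn (b i) : ℤˣ) : ℤ)) =
        letterVal T ∘ fun i => (b i, s i) := by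
      funext i
      cases h : b i <;> simp [sgn, h]
    rw [xi, this, wordVal, List.map_ofFn]
  intro s
  have h := hU.sum_tensorCoeff (hU.hasOrthogonalEntries hT) hT.isTriangleSystem b s
  simpa only [hxi, ite_smul, one_smul, zero_smul] using h

end IsTriangleMatrix

/-- The relations of `𝔾_T` are thus among those of the planar quantization; this needs that no
triple outside `T` becomes trivial in the group. -/
theorem xi_eq_xiT {T : Set (F × F × F)} (hT : IsTriangleSystem T) :
    xi (PresentedGroup.of : F → TriangleGroup T) (fun _ : Fin 3 => 1) = xiT T := by
  classical
  funext s
  unfold xi xiT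
  refine if_congr (Iff.trans ?_ ⟨mem_of_of_mul_of_mul_of_eq_one hT, of_mul_of_mul_of⟩) rfl rfl
  simp [List.ofFn_succ, mul_assoc]

end Matrix

/-! ### Isomorphisms of universal compact quantum groups -/

section Iso

universe u

variable {F : Type u} [Fintype F] [DecidableEq F] {P Q : Conditions F}

theorem isTriangleMatrix_u {T : Set (F × F × F)} (hT : IsTrianglePresentation T) :
    IsTriangleMatrix T (UnivAlg.u (triangleConditions T)) := by
  have hI := UnivAlg.u_invariant (P := triangleConditions T) .intro
  refine ⟨UnivAlg.u_unitary, conj_unitary_of_triangle hT UnivAlg.u_unitary hI, fun a b c => ?_⟩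
  have h := hI ![a, b, c]
  rw [← sum_fin_three (fun p q r => ind T p q r • (UnivAlg.u (triangleConditions T) a p *
    (UnivAlg.u (triangleConditions T) b q * UnivAlg.u (triangleConditions T) c r)))]
  by_cases habc : (a, b, c) ∈ T <;>
    simpa [tensorCoeff, List.ofFn_succ, signed_one, xiT, ind, habc] using h

namespace UnivAlg

/-- Two `*`-homomorphisms between universal algebras that respect the generators are mutually
inverse. -/
def starAlgEquiv (f : UnivAlg P →ₐ[ℂ] UnivAlg Q) (g : UnivAlg Q →ₐ[ℂ] UnivAlg P)
    (hf : ∀ a, f (star a) = star (f a)) (hg : ∀ a, g (star a) = star (g a))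
    (hfu : ∀ s t, f (u P s t) = u Q s t) (hgu : ∀ s t, g (u Q s t) = u P s t) :
    UnivAlg P ≃⋆ₐ[ℂ] UnivAlg Q :=
  StarAlgEquiv.ofAlgEquiv (AlgEquiv.ofAlgHom f g
    (algHom_ext fun e s t => by
      rcases Int.units_eq_one_or e with rfl | rfl <;> simp [signed, hf, hg, hfu, hgu])
    (algHom_ext fun e s t => by
      rcases Int.units_eq_one_or e with rfl | rfl <;> simp [signed, hf, hg, hfu, hgu])) hf

theorem comulHom_map (f : UnivAlg P →ₐ[ℂ] UnivAlg Q) (hf : ∀ a, f (star a) = star (f a))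
    (hfu : ∀ s t, f (u P s t) = u Q s t) (a : UnivAlg P) :
    comulHom Q (f a) = Algebra.TensorProduct.map f f (comulHom P a) := by
  have hs : ∀ e s t, f (signed (u P) e s t) = signed (u Q) e s t := fun e s t => by
    rcases Int.units_eq_one_or e with rfl | rfl <;> simp [signed, hf, hfu]
  refine DFunLike.congr_fun (algHom_ext (f := (comulHom Q).comp f)
    (g := (Algebra.TensorProduct.map f f).comp (comulHom P)) fun e s t => ?_) a
  simp [comulHom_signed, hs]

end UnivAlg

end Iso

end PlanarQuantization

/-! ### The isomorphism with the planar quantization -/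

open PlanarQuantization in
theorem mainTheorem7 {F : Type*} [Fintype F] [DecidableEq F] {T : Set (F × F × F)}
    (hT : PlanarQuantization.IsTrianglePresentation T) :
    ∃ ι : F ↪ PlanarQuantization.TriangleGroup T,
      (∀ s, ι s = PresentedGroup.of s) ∧
      Subgroup.closure (Set.range ι) = ⊤ ∧
      (∀ n : ℕ, 1 ≤ n → ∀ ε : Fin n → ℤˣ,
        PlanarQuantization.IsInvariant (PlanarQuantization.triangleU hT) ε
          (PlanarQuantization.xi ι ε)) ∧
      ∃ Φ : (PlanarQuantization.triangleQuantumGroup hT).Iso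
          (PlanarQuantization.planarQuantumGroup ι),
        ∀ s t, Φ.toStarAlgEquiv (PlanarQuantization.triangleU hT s t) =
          PlanarQuantization.planarU ι s t := by
  have hU := isTriangleMatrix_u hT
  have hinv := fun (n : ℕ) (ε : Fin n → ℤˣ) => hU.isInvariant_xi hT ε
  let ι : F ↪ TriangleGroup T := ⟨PresentedGroup.of, of_injective hT.isTriangleSystem⟩
  refine ⟨ι, fun _ => rfl, PresentedGroup.closure_range_of _, fun n _ ε => hinv n ε, ?_⟩
  have hI : ∀ n ε ξ, (triangleConditions T).invariant n ε ξ →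
      IsInvariant (UnivAlg.u (planarConditions ι)) ε ξ := by
    rintro _ _ _ ⟨⟩
    exact UnivAlg.u_invariant ⟨by norm_num, (xi_eq_xiT hT.isTriangleSystem).symm⟩
  have hJ : ∀ n ε ξ, (planarConditions ι).invariant n ε ξ →
      IsInvariant (UnivAlg.u (triangleConditions T)) ε ξ := by
    rintro n ε _ ⟨-, rfl⟩
    exact hinv n ε
  -- Unitarity of the conjugate is not among the conditions for `𝔾_T`, so nothing is to be checked
  -- here; in the other direction it is supplied by `hU.conj`.
  let f := UnivAlg.univLift (P := triangleConditions T) _ UnivAlg.u_unitary (fun h => h.elim) hI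
  let g := UnivAlg.univLift (P := planarConditions ι) _ UnivAlg.u_unitary (fun _ => hU.conj) hJ
  have hf : ∀ a, f (star a) = star (f a) := UnivAlg.univLift_star _ _ _ _
  have hg : ∀ a, g (star a) = star (g a) := UnivAlg.univLift_star _ _ _ _
  have hfu : ∀ s t, f (UnivAlg.u _ s t) = UnivAlg.u _ s t := UnivAlg.univLift_u _ _ _ _
  have hgu : ∀ s t, g (UnivAlg.u _ s t) = UnivAlg.u _ s t := UnivAlg.univLift_u _ _ _ _
  exact ⟨⟨UnivAlg.starAlgEquiv f g hf hg hfu hgu, UnivAlg.comulHom_map f hf hfu⟩, hfu⟩
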